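/- Work with power series in variables $p_1,p_2,\dots$, where $p_i$ has degree $i$. For $F\in\mathbb{Q}[[p_1,p_2,\dots]]$ and $G\in\mathbb{Q}[[p_1,p_2,\dots]]$ without constant term, let $F[G]=F(G(p_1,p_2,p_3,\dots),G(p_2,p_4,p_6,\dots),G(p_3,p_6,p_9,\dots),\dots)$ denote plethysm, and let $F^\sim(p_1,p_2,p_3,p_4,\dots)=F(p_1,-p_2,p_3,-p_4,\dots)$. Put $$\mathrm{Sinh}=\tfrac12\Bigl(\exp\bigl(\sum_{i\ge1}p_i/i\bigr)-\exp\bigl(\sum_{i\ge1}(-1)^ip_i/i\bigr)\Bigr),$$ let $\mathrm{Arcsinh}^\sim$ be the unique power series without constant term such that $\mathrm{Sinh}^\sim[\mathrm{Arcsinh}^\sim]=\mathrm{Arcsinh}^\sim[\mathrm{Sinh}^\sim]=p_1$, and let $$X=\sum_{k\ge1,\ k\text{ odd}}\frac1k\,\mathrm{Arcsinh}^\sim[p_k].$$ Let $K$ be a commutative $\mathbb{Q}$-algebra, and let $\chi=(\chi_n)_{n\ge0}$ be a sequence of $K$-valued class functions $\chi_n:S_n\to K$ (for example a virtual character, possibly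 graded, of the category of finite sets and bijections). For a permutation $\pi$ let $n_m=n_m(\pi)$ be the number of its $m$-cycles, fixed points being the $1$-cycles, and let the cycle index of $\chi$ be $$Z_\chi=\sum_{n\ge0}\frac1{n!}\sum_{\pi\in S_n}\chi_n(\pi)\prod_{i\ge1}p_i^{n_i(\pi)}\in K[[p_1,p_2,\dots]].$$ Suppose that $$Z_\chi=\exp\Bigl(\sum_{l\ge1}c_l\,X[p_l]/l\Bigr)$$ for a sequence of constants $c_1,c_2,\dots\in K$. Then for every $n\ge0$ and every $\pi\in S_n$, $$\chi_n(\pi)=\prod_{l\ge1}\Bigl((c_l+o_l)\prod_{0\le i\le n_l-2}\bigl(c_l+o_l+l(n_l-2-2i)\bigr)\Bigr),\qquad o_l=o_l(\pi)=\sum_{k\ge1,\ 2^k\mid l}2^{-k}l\,n_{2^{-k}l}(\pi),$$ where for $n_l=0$ the inner product has $-1$ terms and stands for $(c_l+o_l)^{-1}$, so that the whole $l$-th factor is taken to be $1$. -/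

import Mathlib

open MvPowerSeries

noncomputable section

/-! # Power series in the power sums `p₁, p₂, …`

The variable `X i`, `i : ℕ+`, is the power sum `p_i`, of `p`-degree `i`. -/

namespace PowerSum

/-- The `p`-degree of the monomial `∏ p_i ^ (m i)`, namely `∑ i * m i`. -/
def pDegree (m : ℕ+ →₀ ℕ) : ℕ := Finsupp.weight (fun i : ℕ+ => (i : ℕ)) m

/-- The series `G[p_k] = G(p_k, p_{2k}, p_{3k}, …)`. -/
def dilate (k : ℕ+) (G : MvPowerSeries ℕ+ ℚ) : MvPowerSeries ℕ+ ℚ :=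
  subst (fun j : ℕ+ => (X (k * j) : MvPowerSeries ℕ+ ℚ)) G

/-- Plethysm `F[G] = F(G(p₁, p₂, …), G(p₂, p₄, …), G(p₃, p₆, …), …)`, for `G` without constant
term. -/
def plethysm (F G : MvPowerSeries ℕ+ ℚ) : MvPowerSeries ℕ+ ℚ :=
  subst (fun k : ℕ+ => dilate k G) F

/-- `A` is a (two-sided) plethystic inverse of `F`. -/
def IsPlethysticInverse (F A : MvPowerSeries ℕ+ ℚ) : Prop :=
  constantCoeff A = 0 ∧ plethysm F A = X 1 ∧ plethysm A F = X 1

section Sums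

variable {R : Type*} [CommRing R] [Algebra ℚ R]

/-- The sum of a locally finite family of power series (every monomial occurs in only finitely
many members), computed coefficient by coefficient. -/
def seriesSum (f : ℕ+ → MvPowerSeries ℕ+ R) : MvPowerSeries ℕ+ R :=
  fun m => ∑ᶠ l : ℕ+, coeff m (f l)

/-- `exp(f)` for a power series `f` without constant term. -/
def expSeries (f : MvPowerSeries ℕ+ R) : MvPowerSeries ℕ+ R :=
  (PowerSeries.exp R).subst f

end Sums

/-- `Sinh = (exp(∑ p_i / i) - exp(∑ (-1)^i p_i / i)) / 2`. -/
def Sinh : MvPowerSeries ℕ+ ℚ :=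
  (1 / 2 : ℚ) •
    (expSeries (seriesSum fun i : ℕ+ => (1 / (i : ℚ)) • X i)
      - expSeries (seriesSum fun i : ℕ+ => ((-1) ^ (i : ℕ) / (i : ℚ)) • X i))

/-- `F^∼ = F(p₁, -p₂, p₃, -p₄, …)`. -/
def tilde (F : MvPowerSeries ℕ+ ℚ) : MvPowerSeries ℕ+ ℚ :=
  rescale (fun i : ℕ+ => (-1 : ℚ) ^ ((i : ℕ) + 1)) F

/-! ### Existence and uniqueness of plethystic inverses -/

/-- All monomials of `f` have `p`-degree at least `n`. -/
def DegGE (n : ℕ) (f : MvPowerSeries ℕ+ ℚ) : Prop :=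
  ∀ m, pDegree m < n → coeff m f = 0

theorem degGE_iff {n : ℕ} {f : MvPowerSeries ℕ+ ℚ} :
    DegGE n f ↔ (n : ℕ∞) ≤ weightedOrder (fun i : ℕ+ => (i : ℕ)) f := by
  constructor
  · intro h
    exact nat_le_weightedOrder _ h
  · intro h m hm
    exact coeff_eq_zero_of_lt_weightedOrder (fun i : ℕ+ => (i : ℕ))
      (lt_of_lt_of_le (Nat.cast_lt.2 hm) h)

theorem DegGE.mul {a b : ℕ} {f g : MvPowerSeries ℕ+ ℚ} (hf : DegGE a f) (hg : DegGE b g) :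
    DegGE (a + b) (f * g) := by
  rw [degGE_iff] at *
  push_cast
  exact (add_le_add hf hg).trans (le_weightedOrder_mul _)

theorem DegGE.add {n : ℕ} {f g : MvPowerSeries ℕ+ ℚ} (hf : DegGE n f) (hg : DegGE n g) :
    DegGE n (f + g) := fun m hm => by simp [hf m hm, hg m hm]

theorem DegGE.sub {n : ℕ} {f g : MvPowerSeries ℕ+ ℚ} (hf : DegGE n f) (hg : DegGE n g) :
    DegGE n (f - g) := fun m hm => by simp [hf m hm, hg m hm]

theorem DegGE.mono {a b : ℕ} {f : MvPowerSeries ℕ+ ℚ} (hf : DegGE b f) (h : a ≤ b) :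
    DegGE a f := fun m hm => hf m (lt_of_lt_of_le hm h)

theorem DegGE.zero_left (f : MvPowerSeries ℕ+ ℚ) : DegGE 0 f := fun m hm => by simp at hm

theorem pDegree_add (m n : ℕ+ →₀ ℕ) : pDegree (m + n) = pDegree m + pDegree n := by
  simp [pDegree]

theorem pDegree_single (i : ℕ+) (e : ℕ) : pDegree (Finsupp.single i e) = e * i := by
  simp [pDegree, Finsupp.weight_single]

theorem pDegree_le (m : ℕ+ →₀ ℕ) (i : ℕ+) : m i * i ≤ pDegree m := by
  have : m = Finsupp.single i (m i) + m.erase i := (Finsupp.single_add_erase i m).symm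
  conv_rhs => rw [this]
  rw [pDegree_add, pDegree_single]
  omega

theorem pDegree_eq_zero {m : ℕ+ →₀ ℕ} (h : pDegree m = 0) : m = 0 := by
  ext i
  have := pDegree_le m i
  have hi := i.pos
  rw [h] at this
  simpa using this

theorem pDegree_eq_one {m : ℕ+ →₀ ℕ} (h : pDegree m = 1) : m = Finsupp.single 1 1 := by
  have hne : m ≠ 0 := by rintro rfl; simp [pDegree] at h
  obtain ⟨i, hi⟩ := Finsupp.ne_iff.1 hne
  simp only [Finsupp.coe_zero, Pi.zero_apply] at hi
  have h1 := pDegree_le m i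
  rw [h] at h1
  have hmi : m i = 1 := by
    have := i.pos
    have : m i * 1 ≤ m i * i := Nat.mul_le_mul_left _ this
    omega
  have hii : i = 1 := by
    rw [hmi] at h1
    have := i.pos
    have h2 : (i : ℕ) = 1 := by omega
    exact PNat.coe_eq_one_iff.1 h2
  subst hii
  have h2 : m = Finsupp.single 1 (m 1) + m.erase 1 := (Finsupp.single_add_erase 1 m).symm
  have h3 : pDegree (m.erase 1) = 0 := by
    have := congrArg pDegree h2
    rw [pDegree_add, pDegree_single, hmi, h] at this
    simpa using this
  rw [h2, pDegree_eq_zero h3, hmi, add_zero]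

theorem degGE_one {f : MvPowerSeries ℕ+ ℚ} : DegGE 1 f ↔ constantCoeff f = 0 := by
  constructor
  · intro h
    have := h 0 (by simp [pDegree])
    simpa using this
  · intro h m hm
    rw [pDegree_eq_zero (m := m) (by omega)]
    simpa using h

theorem degGE_X (i : ℕ+) : DegGE i (X i : MvPowerSeries ℕ+ ℚ) := by
  classical
  intro m hm
  rw [coeff_X, if_neg]
  rintro rfl
  simp [pDegree_single] at hm

theorem degGE_prod {k : ℕ} {a : ℕ+ → MvPowerSeries ℕ+ ℚ} (ha : ∀ s : ℕ+, DegGE (k * s) (a s))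
    (d : ℕ+ →₀ ℕ) : DegGE (k * pDegree d) (d.prod fun s e => a s ^ e) := by
  induction d using Finsupp.induction_linear with
  | zero => simpa [pDegree] using DegGE.zero_left _
  | add f g hf hg =>
    rw [Finsupp.prod_add_index' (by simp) (by intros; rw [pow_add]), pDegree_add, mul_add]
    exact hf.mul hg
  | single s e =>
    rw [Finsupp.prod_single_index (by simp), pDegree_single]
    induction e with
    | zero => simpa using DegGE.zero_left _
    | succ e ih =>
      rw [pow_succ, show k * ((e + 1) * (s : ℕ)) = k * (e * s) + k * s by ring]
      exact ih.mul (ha s)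

theorem hasSubst_of_degGE {k : ℕ} (hk : 0 < k) {a : ℕ+ → MvPowerSeries ℕ+ ℚ}
    (ha : ∀ s : ℕ+, DegGE (k * s) (a s)) : HasSubst a where
  const_coeff s := by
    have : DegGE 1 (a s) := (ha s).mono (Nat.mul_pos hk s.pos)
    rw [degGE_one.1 this]
    exact IsNilpotent.zero
  coeff_zero d := by
    refine (Set.finite_Iic (⟨pDegree d + 1, by omega⟩ : ℕ+)).subset ?_
    intro s hs
    by_contra hlt
    rw [Set.mem_Iic] at hlt
    have hlt' : ¬ ((s : ℕ) ≤ pDegree d + 1) := fun h => hlt h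
    exact hs (ha s d (lt_of_lt_of_le (by omega) (Nat.le_mul_of_pos_left (s : ℕ) hk)))

theorem degGE_subst {k n : ℕ} (hk : 0 < k) {a : ℕ+ → MvPowerSeries ℕ+ ℚ}
    (ha : ∀ s : ℕ+, DegGE (k * s) (a s)) {f : MvPowerSeries ℕ+ ℚ} (hf : DegGE n f) :
    DegGE (k * n) (subst a f) := by
  intro m hm
  rw [coeff_subst (hasSubst_of_degGE hk ha)]
  refine finsum_eq_zero_of_forall_eq_zero fun d => ?_
  by_cases hd : pDegree d < n
  · rw [hf d hd, zero_smul]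
  · rw [degGE_prod ha d m (lt_of_lt_of_le hm (Nat.mul_le_mul_left _ (not_lt.1 hd))), smul_zero]

theorem degGE_mul_X (k s : ℕ+) : DegGE (k * s) (X (k * s) : MvPowerSeries ℕ+ ℚ) := by
  simpa using degGE_X (k * s)

theorem hasSubst_X_mul (k : ℕ+) :
    HasSubst (fun j : ℕ+ => (X (k * j) : MvPowerSeries ℕ+ ℚ)) :=
  hasSubst_of_degGE k.pos (degGE_mul_X k)

theorem DegGE.dilate {n : ℕ} {G : MvPowerSeries ℕ+ ℚ} (hG : DegGE n G) (k : ℕ+) :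
    DegGE (k * n) (dilate k G) :=
  degGE_subst k.pos (degGE_mul_X k) hG

theorem degGE_dilate_one {G : MvPowerSeries ℕ+ ℚ} (hG : constantCoeff G = 0) (k : ℕ+) :
    DegGE (1 * k) (PowerSum.dilate k G) := by
  have := (degGE_one.2 hG).dilate k
  rwa [mul_one, ← one_mul (k : ℕ)] at this

theorem hasSubst_dilate {G : MvPowerSeries ℕ+ ℚ} (hG : constantCoeff G = 0) :
    HasSubst (fun k : ℕ+ => PowerSum.dilate k G) :=
  hasSubst_of_degGE one_pos (degGE_dilate_one hG)

theorem DegGE.plethysm {n : ℕ} {F G : MvPowerSeries ℕ+ ℚ} (hF : DegGE n F)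
    (hG : constantCoeff G = 0) : DegGE n (plethysm F G) := by
  have := degGE_subst one_pos (degGE_dilate_one hG) hF
  rwa [one_mul] at this

theorem dilate_one (G : MvPowerSeries ℕ+ ℚ) : dilate 1 G = G := by
  have : (fun j : ℕ+ => (X (1 * j) : MvPowerSeries ℕ+ ℚ)) = X := by
    funext j; rw [one_mul]
  rw [dilate, this, subst_self, id]

theorem plethysm_X {G : MvPowerSeries ℕ+ ℚ} (hG : constantCoeff G = 0) (k : ℕ+) :
    plethysm (X k) G = dilate k G := by
  rw [plethysm, subst_X (hasSubst_dilate hG)]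

theorem dilate_X (j k : ℕ+) : dilate j (X k : MvPowerSeries ℕ+ ℚ) = X (j * k) := by
  rw [dilate, subst_X (hasSubst_X_mul j)]

/-- `F[p_k]` is the plethysm of `F` with the series `p_k`. -/
theorem plethysm_eq_dilate (F : MvPowerSeries ℕ+ ℚ) (k : ℕ+) :
    plethysm F (X k) = dilate k F := by
  simp only [plethysm, dilate_X]
  rw [dilate]
  simp only [mul_comm k]

theorem dilate_plethysm (F : MvPowerSeries ℕ+ ℚ) {G : MvPowerSeries ℕ+ ℚ}
    (hG : constantCoeff G = 0) (k : ℕ+) :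
    dilate k (plethysm F G) = subst (fun j : ℕ+ => dilate (k * j) G) F := by
  rw [plethysm, dilate, subst_comp_subst_apply (hasSubst_dilate hG) (hasSubst_X_mul k)]
  congr 1
  funext j
  rw [dilate, dilate, subst_comp_subst_apply (hasSubst_X_mul j) (hasSubst_X_mul k)]
  congr 1
  funext i
  rw [subst_X (hasSubst_X_mul k), mul_assoc]

theorem plethysm_dilate (F : MvPowerSeries ℕ+ ℚ) {G : MvPowerSeries ℕ+ ℚ}
    (hG : constantCoeff G = 0) (k : ℕ+) :
    plethysm (dilate k F) G = subst (fun j : ℕ+ => dilate (k * j) G) F := by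
  rw [plethysm, dilate, subst_comp_subst_apply (hasSubst_X_mul k) (hasSubst_dilate hG)]
  congr 1
  funext j
  rw [subst_X (hasSubst_dilate hG)]

theorem plethysm_assoc (F : MvPowerSeries ℕ+ ℚ) {G H : MvPowerSeries ℕ+ ℚ}
    (hG : constantCoeff G = 0) (hH : constantCoeff H = 0) :
    plethysm (plethysm F G) H = plethysm F (plethysm G H) := by
  have h : ∀ k, dilate k (plethysm G H) = plethysm (dilate k G) H := fun k => by
    rw [dilate_plethysm G hH, plethysm_dilate G hH]
  simp only [plethysm.eq_def F (plethysm G H), h]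
  rw [plethysm.eq_def (plethysm F G) H, plethysm.eq_def F G,
    subst_comp_subst_apply (hasSubst_dilate hG) (hasSubst_dilate hH)]
  rfl

theorem plethysm_X_one (F : MvPowerSeries ℕ+ ℚ) : plethysm F (X 1) = F := by
  rw [plethysm_eq_dilate, dilate_one]

theorem prod_sub_prod {n : ℕ} {a b : ℕ+ → MvPowerSeries ℕ+ ℚ}
    (ha : ∀ s : ℕ+, DegGE (1 * s) (a s)) (hb : ∀ s : ℕ+, DegGE (1 * s) (b s))
    (hab : ∀ s : ℕ+, DegGE (n + s) (a s - b s)) (d : ℕ+ →₀ ℕ) :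
    DegGE (n + pDegree d) ((d.prod fun s e => a s ^ e) - d.prod fun s e => b s ^ e) := by
  have key : ∀ (i j : ℕ) (x x' y y' : MvPowerSeries ℕ+ ℚ), DegGE i x → DegGE j y' →
      DegGE (n + i) (x - x') → DegGE (n + j) (y - y') →
      DegGE (n + (i + j)) (x * y - x' * y') := by
    intro i j x x' y y' hx hy' hxx hyy
    have e : x * y - x' * y' = x * (y - y') + (x - x') * y' := by ring
    rw [e]
    refine DegGE.add ?_ ?_
    · exact (hx.mul hyy).mono (by omega)
    · exact (hxx.mul hy').mono (by omega)
  induction d using Finsupp.induction_linear with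
  | zero => intro m _; simp
  | add f g hf hg =>
    rw [Finsupp.prod_add_index' (by simp) (by intros; rw [pow_add]),
      Finsupp.prod_add_index' (by simp) (by intros; rw [pow_add]), pDegree_add]
    have h1 := degGE_prod ha f
    have h2 := degGE_prod hb g
    rw [one_mul] at h1 h2
    exact key _ _ _ _ _ _ h1 h2 hf hg
  | single s e =>
    rw [Finsupp.prod_single_index (by simp), Finsupp.prod_single_index (by simp)]
    induction e with
    | zero => intro m _; simp
    | succ e ih =>
      have h1 := degGE_prod ha (Finsupp.single s e)
      rw [Finsupp.prod_single_index (by simp), one_mul] at h1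
      have h2 := hb s
      rw [one_mul] at h2
      have := key _ _ _ _ _ _ h1 h2 ih (hab s)
      rw [pow_succ, pow_succ, Finsupp.single_add, pDegree_add, pDegree_single s 1, one_mul]
      exact this

/-- Plethysm by a series without terms of degree at most one increases the order of
agreement. -/
theorem plethysm_sub_plethysm {n : ℕ} {H A B : MvPowerSeries ℕ+ ℚ} (hH : DegGE 2 H)
    (hA : constantCoeff A = 0) (hB : constantCoeff B = 0) (hAB : DegGE (n + 1) (A - B)) :
    DegGE (n + 2) (plethysm H A - plethysm H B) := by
  have hab : ∀ s : ℕ+, DegGE (n + s) (dilate s A - dilate s B) := by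
    intro s
    have h1 := hAB.dilate s
    rw [PowerSum.dilate, subst_sub (hasSubst_X_mul s)] at h1
    refine h1.mono ?_
    have : 1 * n ≤ s * n := Nat.mul_le_mul_right _ s.pos
    rw [mul_add, mul_one]
    omega
  intro m hm
  rw [map_sub, sub_eq_zero, plethysm, plethysm, coeff_subst (hasSubst_dilate hA),
    coeff_subst (hasSubst_dilate hB)]
  refine finsum_congr fun d => ?_
  by_cases hd : pDegree d < 2
  · rw [hH d hd, zero_smul, zero_smul]
  · have := prod_sub_prod (degGE_dilate_one hA) (degGE_dilate_one hB) hab d m (by omega)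
    rw [map_sub, sub_eq_zero] at this
    rw [this]

theorem exists_right_inverse {F : MvPowerSeries ℕ+ ℚ} (h0 : constantCoeff F = 0)
    (h1 : coeff (Finsupp.single 1 1) F = 1) :
    ∃ A : MvPowerSeries ℕ+ ℚ, constantCoeff A = 0 ∧
      coeff (Finsupp.single 1 1) A = 1 ∧ plethysm F A = X 1 := by
  classical
  set H : MvPowerSeries ℕ+ ℚ := F - X 1 with hHdef
  have hH : DegGE 2 H := by
    intro m hm
    rcases Nat.lt_or_ge (pDegree m) 1 with h | h
    · rw [pDegree_eq_zero (m := m) (by omega)]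
      simp [hHdef, h0]
    · rw [pDegree_eq_one (m := m) (by omega), hHdef, map_sub, h1, coeff_X, if_pos rfl, sub_self]
  let Φ : MvPowerSeries ℕ+ ℚ → MvPowerSeries ℕ+ ℚ := fun A => X 1 - plethysm H A
  have hX : DegGE 1 (X 1 : MvPowerSeries ℕ+ ℚ) := degGE_X 1
  have hΦ : ∀ A, constantCoeff A = 0 → constantCoeff (Φ A) = 0 := fun A hA =>
    degGE_one.1 (hX.sub ((hH.plethysm hA).mono (by omega)))
  have hΦsub : ∀ (n : ℕ) (A B), constantCoeff A = 0 → constantCoeff B = 0 →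
      DegGE (n + 1) (A - B) → DegGE (n + 2) (Φ A - Φ B) := by
    intro n A B hA hB hAB
    have e : Φ A - Φ B = 0 - (plethysm H A - plethysm H B) := by simp only [Φ]; ring
    rw [e]
    exact DegGE.sub (fun m _ => by simp) (plethysm_sub_plethysm hH hA hB hAB)
  let S : ℕ → MvPowerSeries ℕ+ ℚ := fun n => Φ^[n] 0
  have hS : ∀ n, S (n + 1) = Φ (S n) := fun n => Function.iterate_succ_apply' Φ n 0
  have hS0 : ∀ n, constantCoeff (S n) = 0 := by
    intro n
    induction n with
    | zero => simp [S]
    | succ n ih => rw [hS]; exact hΦ _ ih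
  have hstep : ∀ n, DegGE (n + 1) (S (n + 1) - S n) := by
    intro n
    induction n with
    | zero => exact (degGE_one.2 (hS0 1)).sub (degGE_one.2 (hS0 0))
    | succ n ih =>
      rw [hS (n + 1)]
      conv => arg 2; arg 2; rw [hS n]
      exact hΦsub n _ _ (hS0 _) (hS0 _) ih
  have hstable : ∀ (k n : ℕ) (m : ℕ+ →₀ ℕ), pDegree m ≤ n →
      coeff m (S (n + k)) = coeff m (S n) := by
    intro k
    induction k with
    | zero => intros; rfl
    | succ k ih =>
      intro n m hm
      rw [← ih n m hm]
      have := hstep (n + k) m (by omega)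
      rw [map_sub, sub_eq_zero] at this
      exact this
  let A : MvPowerSeries ℕ+ ℚ := fun m => coeff m (S (pDegree m))
  have hAc : ∀ m, coeff m A = coeff m (S (pDegree m)) := fun m => rfl
  have hAS : ∀ n, DegGE (n + 1) (A - S n) := by
    intro n m hm
    rw [map_sub, hAc, sub_eq_zero]
    obtain ⟨k, hk⟩ := Nat.exists_eq_add_of_le (show pDegree m ≤ n by omega)
    rw [hk, hstable k _ m le_rfl]
  have hA0 : constantCoeff A = 0 := by
    have := hAS 0 0 (by simp [pDegree])
    simpa [S] using this
  have hfix : Φ A = A := by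
    ext m
    have h2 := hΦsub (pDegree m) _ _ hA0 (hS0 _) (hAS (pDegree m)) m (by omega)
    have h3 := hAS (pDegree m + 1) m (by omega)
    rw [map_sub, sub_eq_zero] at h2 h3
    rw [h2, h3, hS]
  have hsplit : plethysm H A = plethysm F A - A := by
    rw [hHdef, plethysm, subst_sub (hasSubst_dilate hA0)]
    change plethysm F A - plethysm (X 1) A = _
    rw [plethysm_X hA0, dilate_one]
  refine ⟨A, hA0, ?_, ?_⟩
  · have h2 := hH.plethysm hA0 (Finsupp.single 1 1) (by simp [pDegree_single])
    rw [← hfix]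
    simp only [Φ]
    rw [map_sub, h2, coeff_X, if_pos rfl, sub_zero]
  · have : X 1 - plethysm H A = A := hfix
    rw [hsplit] at this
    linear_combination (-1 : MvPowerSeries ℕ+ ℚ) * this

theorem existsUnique_plethysticInverse {F : MvPowerSeries ℕ+ ℚ} (h0 : constantCoeff F = 0)
    (h1 : coeff (Finsupp.single 1 1) F = 1) : ∃! A, IsPlethysticInverse F A := by
  obtain ⟨A, hA0, hA1, hFA⟩ := exists_right_inverse h0 h1
  obtain ⟨B, hB0, -, hAB⟩ := exists_right_inverse hA0 hA1
  have hFB : F = B := by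
    have h2 := plethysm_assoc F hA0 hB0
    rw [hFA, hAB, plethysm_X_one, plethysm_X hB0, dilate_one] at h2
    exact h2.symm
  rw [← hFB] at hAB
  refine ⟨A, ⟨hA0, hFA, hAB⟩, ?_⟩
  rintro D ⟨hD0, hFD, -⟩
  have h2 := plethysm_assoc A h0 hD0
  rw [hFD, hAB, plethysm_X_one, plethysm_X hD0, dilate_one] at h2
  exact h2

theorem coeff_seriesSum_smul_X (c : ℕ+ → ℚ) (m : ℕ+ →₀ ℕ) (hm : pDegree m ≤ 1) :
    coeff m (seriesSum fun i : ℕ+ => c i • (X i : MvPowerSeries ℕ+ ℚ)) =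
      if m = Finsupp.single 1 1 then c 1 else 0 := by
  classical
  change (∑ᶠ l : ℕ+, coeff m (c l • (X l : MvPowerSeries ℕ+ ℚ))) = _
  rw [finsum_eq_single _ (1 : ℕ+)]
  · simp [coeff_X]
  · intro l hl
    rw [coeff_smul, coeff_X, if_neg, mul_zero]
    rintro rfl
    rw [pDegree_single, one_mul] at hm
    have h2 : (l : ℕ) = 1 := by have := l.pos; omega
    exact hl (PNat.coe_eq_one_iff.1 h2)

theorem coeff_expSeries {f : MvPowerSeries ℕ+ ℚ} (h0 : constantCoeff f = 0) {m : ℕ+ →₀ ℕ}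
    (hm : pDegree m ≤ 1) : coeff m (expSeries f) = coeff m (1 : MvPowerSeries ℕ+ ℚ) +
      coeff m f := by
  rw [expSeries, PowerSeries.coeff_subst (PowerSeries.HasSubst.of_constantCoeff_zero h0),
    finsum_eq_sum_of_support_subset (s := Finset.range 2)]
  · simp [Finset.sum_range_succ, PowerSeries.coeff_exp]
  · intro n hn
    by_contra hn2
    simp only [Finset.coe_range, Set.mem_Iio, not_lt] at hn2
    apply hn
    have hp : ∀ n : ℕ, DegGE n (f ^ n) := by
      intro n
      induction n with
      | zero => exact DegGE.zero_left _
      | succ n ih => rw [pow_succ]; exact ih.mul (degGE_one.2 h0)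
    simp only [hp n m (by omega), smul_zero]

theorem coeff_tilde_Sinh {m : ℕ+ →₀ ℕ} (hm : pDegree m ≤ 1) :
    coeff m (tilde Sinh) = if m = Finsupp.single 1 1 then 1 else 0 := by
  have h0 : ∀ c : ℕ+ → ℚ,
      constantCoeff (seriesSum fun i : ℕ+ => c i • (X i : MvPowerSeries ℕ+ ℚ)) = 0 := by
    intro c
    rw [← coeff_zero_eq_constantCoeff_apply, coeff_seriesSum_smul_X c 0 (by simp [pDegree])]
    rw [if_neg]
    intro h
    simpa using DFunLike.congr_fun h 1
  rw [tilde, coeff_rescale, Sinh, coeff_smul, map_sub, coeff_expSeries (h0 _) hm,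
    coeff_expSeries (h0 _) hm, coeff_seriesSum_smul_X _ m hm, coeff_seriesSum_smul_X _ m hm]
  split_ifs with h
  · subst h
    norm_num
  · simp

/-- There is exactly one series `A` with `Sinh^∼[A] = A[Sinh^∼] = p₁`. -/
theorem existsUnique_arcsinhTilde : ∃! A, IsPlethysticInverse (tilde Sinh) A := by
  refine existsUnique_plethysticInverse ?_ ?_
  · rw [← coeff_zero_eq_constantCoeff_apply, coeff_tilde_Sinh (by simp [pDegree]), if_neg]
    intro h
    simpa using DFunLike.congr_fun h 1
  · rw [coeff_tilde_Sinh (by simp [pDegree_single]), if_pos rfl]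

/-- `Arcsinh^∼`, the unique series with `Sinh^∼[Arcsinh^∼] = Arcsinh^∼[Sinh^∼] = p₁`. -/
def ArcsinhTilde : MvPowerSeries ℕ+ ℚ := existsUnique_arcsinhTilde.choose

theorem arcsinhTilde_spec : IsPlethysticInverse (tilde Sinh) ArcsinhTilde :=
  existsUnique_arcsinhTilde.choose_spec.1

/-- The series `X = ∑_{k odd} Arcsinh^∼[p_k] / k`. -/
def XSeries : MvPowerSeries ℕ+ ℚ :=
  seriesSum fun k : ℕ+ => if Odd (k : ℕ) then (1 / (k : ℚ)) • plethysm ArcsinhTilde (X k) else 0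

end PowerSum

/-! # Characters of the symmetric groups -/

namespace BijChar

open Equiv

/-- `n_i(π)`, the number of `i`-cycles of `π` (fixed points are the `1`-cycles). -/
def numCycles {n : ℕ} (π : Perm (Fin n)) (i : ℕ) : ℕ := π.partition.parts.count i

/-- The exponent of the monomial `∏ p_i ^ n_i(π)`. -/
def cycleExponent {n : ℕ} (π : Perm (Fin n)) : ℕ+ →₀ ℕ :=
  Finsupp.comapDomain (fun i : ℕ+ => (i : ℕ)) (Multiset.toFinsupp π.partition.parts)
    PNat.coe_injective.injOn

theorem cycleExponent_apply {n : ℕ} (π : Perm (Fin n)) (i : ℕ+) :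
    cycleExponent π i = numCycles π i := by
  simp [cycleExponent, numCycles]

/-- `o_m(π) = ∑_{k ≥ 1, 2^k ∣ m} 2^{-k} m n_{2^{-k} m}(π)` (the condition `2^k ∣ m` forces
`k ≤ m`, since `m ≥ 1`). -/
def o {n : ℕ} (π : Perm (Fin n)) (m : ℕ) : ℕ :=
  ∑ k ∈ (Finset.Icc 1 m).filter (fun k => 2 ^ k ∣ m), (m / 2 ^ k) * numCycles π (m / 2 ^ k)

variable {K : Type*} [CommRing K] [Algebra ℚ K]

/-- A sequence of functions `χ_n : S_n → K`, each constant on conjugacy classes. -/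
def IsClassFunction (χ : (n : ℕ) → Perm (Fin n) → K) : Prop :=
  ∀ (n : ℕ) (σ τ : Perm (Fin n)), χ n (σ * τ * σ⁻¹) = χ n τ

/-- Virtual characters, with coefficients in `K` (for instance power series in a grading
variable), are class functions. -/
theorem isClassFunction_of_mem_span {χ : (n : ℕ) → Perm (Fin n) → K}
    (h : ∀ n, χ n ∈ Submodule.span K
      {f | ∃ V : FDRep ℚ (Perm (Fin n)), f = fun π => algebraMap ℚ K (V.character π)}) :
    IsClassFunction χ := by
  intro n σ τ
  have := h n
  generalize χ n = f at this
  induction this using Submodule.span_induction with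
  | mem f hf => obtain ⟨V, rfl⟩ := hf; simp only [FDRep.char_conj]
  | zero => rfl
  | add f g _ _ hf hg => simp only [Pi.add_apply, hf, hg]
  | smul a f _ hf => simp only [Pi.smul_apply, hf]

/-- The part `(1 / n!) ∑_{π ∈ S_n} χ_n(π) ∏ p_i ^ n_i(π)` of the cycle index. -/
def cycleIndexPart (χ : (n : ℕ) → Perm (Fin n) → K) (n : ℕ) : MvPowerSeries ℕ+ K :=
  (1 / (n.factorial : ℚ)) • ∑ π : Perm (Fin n), monomial (cycleExponent π) (χ n π)

/-- The cycle index `Z_χ = ∑_n (1 / n!) ∑_{π ∈ S_n} χ_n(π) ∏ p_i ^ n_i(π)`, summed coefficient by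
coefficient (the part indexed by `n` only contains monomials of `p`-degree `n`). -/
def cycleIndex (χ : (n : ℕ) → Perm (Fin n) → K) : MvPowerSeries ℕ+ K :=
  fun m => ∑ᶠ n : ℕ, coeff m (cycleIndexPart χ n)

/-- The factor `(c + o) ∏_{0 ≤ i ≤ r - 2} (c + o + l (r - 2 - 2 i))`. For `r = 0` the inner product
has `-1` terms and stands for `(c + o)⁻¹`, so the factor is `1`. -/
def charFactor (c : K) (o l r : ℕ) : K :=
  if r = 0 then 1
  else (c + o) * ∏ i ∈ Finset.range (r - 1), (c + o + l * ((r : K) - 2 - 2 * i))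

end BijChar

end

/-! Write `Z_c` for `exp(∑ c_l X[p_l]/l)`. The proof shows that every coefficient of `Z_c` equals
the closed formula `closedCoeff` (`coeff_expSeries_logSeries`), because both satisfy the same
difference equation in each parameter `c_k`.

Composing the identity Sinh^∼[Arcsinh^∼] = p_1 with `p_k` and splitting the exponents by parity
gives `2 p_k = exp(X[p_k] - E_k) - exp(-X[p_k] - E_k)`, where `E_k` is `evenSeries k`. From `2 E_k =
X[p_{2k}] + E_{2k}` it follows that `E_k = ∑_{i ≥ 1} 2^{-i} X[p_{2^i k}]`. Multiplying by
`exp(±X[p_k])` shifts `c_k` by `±k`, and multiplying by `exp(E_k)` adds `k` to every `c_{2^i k}`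
with `i ≥ 1`; this last shift is `shiftWeight k`. Hence `Z_{c + k e_k} - Z_{c - k e_k} = 2 p_k Z_{c
+ shiftWeight k}` (`expSeries_logSeries_sub`).

The closed formula obeys the same equation (`closedCoeff_sub`): an additional `k`-cycle raises `o_l`
by exactly `shiftWeight k l`, and only the sum `c_l + o_l` enters the `l`-th factor.

By induction on `p`-degree, the difference of the two sides is then periodic in each `c_k` with
period `2k`. It is also polynomial in `c_k`, hence independent of it
(`eq_of_polynomial_of_periodic`). So all relevant `c_l` may be set to zero, where the comparison is
immediate. Finally, the coefficient of the cycle index at the type of `π` is `χ_n(π)` divided by the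
order of the centralizer of `π`. -/

namespace PowerSum

/-! ### Exponentials of power series. -/

section Exp

theorem coeff_pow_congr {R : Type*} [CommRing R] {f g : MvPowerSeries ℕ+ R} {m : ℕ+ →₀ ℕ}
    (h : ∀ m' ≤ m, coeff m' f = coeff m' g) (n : ℕ) : coeff m (f ^ n) = coeff m (g ^ n) := by
  classical
  induction n generalizing m with
  | zero => simp
  | succ n ih =>
    rw [pow_succ, pow_succ, coeff_mul, coeff_mul]
    refine Finset.sum_congr rfl fun p hp => ?_
    have hp' := Finset.HasAntidiagonal.mem_antidiagonal.1 hp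
    have h1 : p.1 ≤ m := hp' ▸ le_self_add
    have h2 : p.2 ≤ m := hp' ▸ le_add_self
    rw [ih fun m' hm' => h m' (hm'.trans h1), h _ h2]

variable {R : Type*} [CommRing R] [Algebra ℚ R]

/-- The universal case of `exp(f + g) = exp(f) exp(g)`; on coefficients it says that `1/(a+b)!`
times the binomial coefficient is `1/(a! b!)`. -/
theorem exp_subst_X_add_X :
    ((PowerSeries.exp R).subst (X 0 + X 1 : MvPowerSeries (Fin 2) R)) =
      (PowerSeries.exp R).subst (X 0 : MvPowerSeries (Fin 2) R) *
        (PowerSeries.exp R).subst (X 1 : MvPowerSeries (Fin 2) R) := by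
  ext e
  rw [PowerSeries.coeff_subst_X_zero_add_X_one, PowerSeries.coeff_subst_X_zero_subst_mul_X_one]
  simp only [PowerSeries.coeff_exp]
  rw [← map_natCast (algebraMap ℚ R), ← map_mul, ← map_mul]
  try rw [smul_eq_mul, ← map_mul]
  congr 1
  rw [Nat.cast_add_choose]
  have h0 : ((e 0 + e 1).factorial : ℚ) ≠ 0 := by positivity
  field_simp

theorem expSeries_add {f g : MvPowerSeries ℕ+ R} (hf : constantCoeff f = 0)
    (hg : constantCoeff g = 0) : expSeries (f + g) = expSeries f * expSeries g := by
  have ha : HasSubst ![f, g] := hasSubst_of_constantCoeff_zero (by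
    intro i; fin_cases i <;> simp [hf, hg])
  have key : ∀ u : MvPowerSeries (Fin 2) R, constantCoeff u = 0 →
      subst ![f, g] ((PowerSeries.exp R).subst u) = expSeries (subst ![f, g] u) := by
    intro u hu
    rw [expSeries, PowerSeries.subst, PowerSeries.subst,
      subst_comp_subst_apply (PowerSeries.HasSubst.of_constantCoeff_zero hu).const ha]
  have h := congrArg (subst ![f, g]) (exp_subst_X_add_X (R := R))
  rw [subst_mul ha, key _ (by simp), key _ (by simp), key _ (by simp), subst_add ha, subst_X ha,
    subst_X ha] at h
  simpa using h

theorem expSeries_zero : expSeries (0 : MvPowerSeries ℕ+ R) = 1 := by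
  rw [expSeries, PowerSeries.subst_zero_eq_C_constantCoeff]
  simp

theorem map_expSeries {f : MvPowerSeries ℕ+ ℚ} (hf : constantCoeff f = 0) :
    (expSeries f).map (algebraMap ℚ R) = expSeries (f.map (algebraMap ℚ R)) := by
  rw [expSeries, expSeries, ← PowerSeries.map_exp (algebraMap ℚ R)]
  exact PowerSeries.map_subst (PowerSeries.HasSubst.of_constantCoeff_zero hf) _

theorem subst_expSeries {a : ℕ+ → MvPowerSeries ℕ+ R} (ha : HasSubst a)
    {f : MvPowerSeries ℕ+ R} (hf : constantCoeff f = 0) :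
    subst a (expSeries f) = expSeries (subst a f) := by
  rw [expSeries, expSeries, PowerSeries.subst, PowerSeries.subst,
    subst_comp_subst_apply (PowerSeries.HasSubst.of_constantCoeff_zero hf).const ha]

/-- Without a constant term, `f ^ n` has no monomials of total degree below `n`, so the exponential
series can be truncated. -/
theorem coeff_expSeries_eq_sum {f : MvPowerSeries ℕ+ R} (hf : constantCoeff f = 0)
    (m : ℕ+ →₀ ℕ) : coeff m (expSeries f) = ∑ n ∈ Finset.range (m.degree + 1),
      algebraMap ℚ R (1 / n.factorial) * coeff m (f ^ n) := by
  rw [expSeries, PowerSeries.coeff_subst (PowerSeries.HasSubst.of_constantCoeff_zero hf),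
    finsum_eq_sum_of_support_subset (s := Finset.range (m.degree + 1))]
  · simp
  · intro n hn
    by_contra h
    apply hn
    simp only [Finset.coe_range, Set.mem_Iio, not_lt] at h
    dsimp only
    rw [coeff_eq_zero_of_constantCoeff_nilpotent (m := 1) (by simpa using hf) (by omega),
      smul_zero]

theorem coeff_expSeries_congr {f g : MvPowerSeries ℕ+ R} (hf : constantCoeff f = 0)
    (hg : constantCoeff g = 0) {m : ℕ+ →₀ ℕ} (h : ∀ m' ≤ m, coeff m' f = coeff m' g) :
    coeff m (expSeries f) = coeff m (expSeries g) := by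
  rw [coeff_expSeries_eq_sum hf, coeff_expSeries_eq_sum hg]
  exact Finset.sum_congr rfl fun n _ => by rw [coeff_pow_congr h]

/-- The coefficients of `exp(f + t g)` are polynomial functions of `t`. -/
theorem exists_polynomial_coeff_expSeries {f g : MvPowerSeries ℕ+ R} (hf : constantCoeff f = 0)
    (hg : constantCoeff g = 0) (m : ℕ+ →₀ ℕ) :
    ∃ P : Polynomial R, ∀ t : R, coeff m (expSeries (f + t • g)) = P.eval t := by
  classical
  -- Read off from `exp(f) exp(t g)`, whose second factor has truncated coefficients with `t`
  -- entering through `t ^ n`.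
  refine ⟨∑ p ∈ Finset.HasAntidiagonal.antidiagonal m, Polynomial.C (coeff p.1 (expSeries f)) *
    ∑ n ∈ Finset.range (p.2.degree + 1), Polynomial.C (algebraMap ℚ R (1 / n.factorial)) *
      (Polynomial.X ^ n * Polynomial.C (coeff p.2 (g ^ n))), fun t => ?_⟩
  have htg : constantCoeff (t • g) = 0 := by
    rw [← coeff_zero_eq_constantCoeff_apply, coeff_smul, coeff_zero_eq_constantCoeff_apply, hg,
      mul_zero]
  rw [expSeries_add hf htg, coeff_mul]
  simp only [Polynomial.eval_finsetSum, Polynomial.eval_mul, Polynomial.eval_C,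
    Polynomial.eval_pow, Polynomial.eval_X]
  refine Finset.sum_congr rfl fun p _ => ?_
  rw [coeff_expSeries_eq_sum htg]
  simp only [smul_pow, coeff_smul]

end Exp

/-! ### Locally finite sums and linear series. -/

theorem finsum_eq_finsum_comp {α β M : Type*} [AddCommMonoid M] {e : α → β}
    (he : Function.Injective e) {g : β → M} (hg : Function.support g ⊆ Set.range e) :
    ∑ᶠ b, g b = ∑ᶠ a, g (e a) := by
  rw [← finsum_mem_range he, ← finsum_mem_univ g]
  exact finsum_mem_inter_support_eq' g _ _ fun x hx => by simpa using hg hx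

section LocallyFinite

variable {R : Type*} [CommRing R]

/-- The `l`-th member of the family has no terms of `p`-degree less than `l`. -/
noncomputable def IsGraded (f : ℕ+ → MvPowerSeries ℕ+ R) : Prop :=
  ∀ (l : ℕ+) (m : ℕ+ →₀ ℕ), pDegree m < l → coeff m (f l) = 0

theorem IsGraded.of_coeff {f : ℕ+ → MvPowerSeries ℕ+ R} {S : Type*} [CommRing S]
    {g : ℕ+ → MvPowerSeries ℕ+ S} (hf : IsGraded f)
    (h : ∀ l m, coeff m (f l) = 0 → coeff m (g l) = 0) : IsGraded g :=
  fun l m hm => h l m (hf l m hm)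

/-- An initial segment of indices containing all members with a term `m`. -/
noncomputable def indexBound (m : ℕ+ →₀ ℕ) : Finset ℕ+ := Finset.Iic (Nat.succPNat (pDegree m))

theorem lt_of_notMem_indexBound {m : ℕ+ →₀ ℕ} {l : ℕ+} (h : l ∉ indexBound m) :
    pDegree m < l := by
  rw [indexBound, Finset.mem_Iic, not_le, ← PNat.coe_lt_coe, Nat.succPNat_coe] at h
  omega

theorem IsGraded.coeff_seriesSum {f : ℕ+ → MvPowerSeries ℕ+ R} (hf : IsGraded f)
    (m : ℕ+ →₀ ℕ) : coeff m (seriesSum f) = ∑ l ∈ indexBound m, coeff m (f l) := by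
  change (∑ᶠ l : ℕ+, coeff m (f l)) = _
  refine finsum_eq_sum_of_support_subset _ fun l hl => ?_
  by_contra h
  exact hl (hf l m (lt_of_notMem_indexBound h))

theorem IsGraded.seriesSum_add {f g : ℕ+ → MvPowerSeries ℕ+ R} (hf : IsGraded f)
    (hg : IsGraded g) : seriesSum (fun l => f l + g l) = seriesSum f + seriesSum g := by
  ext m
  have h : IsGraded fun l => f l + g l := fun l m hm => by simp [hf l m hm, hg l m hm]
  rw [map_add, h.coeff_seriesSum, hf.coeff_seriesSum, hg.coeff_seriesSum,
    ← Finset.sum_add_distrib]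
  rfl

theorem seriesSum_smul (r : R) {f : ℕ+ → MvPowerSeries ℕ+ R} (hf : IsGraded f) :
    seriesSum (fun l => r • f l) = r • seriesSum f := by
  ext m
  have h : IsGraded fun l => r • f l := hf.of_coeff fun l m hm => by simp [hm]
  rw [coeff_smul, h.coeff_seriesSum, hf.coeff_seriesSum, Finset.mul_sum]
  rfl

theorem IsGraded.constantCoeff_seriesSum {f : ℕ+ → MvPowerSeries ℕ+ R} (hf : IsGraded f) :
    constantCoeff (seriesSum f) = 0 := by
  rw [← coeff_zero_eq_constantCoeff_apply, hf.coeff_seriesSum]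
  exact Finset.sum_eq_zero fun l _ => hf l 0 (by simp [pDegree])

end LocallyFinite

theorem isGraded_smul_X (b : ℕ+ → ℚ) : IsGraded fun i : ℕ+ => b i • (X i : MvPowerSeries ℕ+ ℚ) :=
  fun l m hm => by rw [coeff_smul, degGE_X l m hm, mul_zero]

theorem isGraded_smul_dilate (b : ℕ+ → ℚ) {G : MvPowerSeries ℕ+ ℚ} (hG : constantCoeff G = 0)
    (k : ℕ+) : IsGraded fun i : ℕ+ => b i • dilate (k * i) G := by
  intro l m hm
  have := degGE_dilate_one hG (k * l) m (by
    have : 1 * (l : ℕ) ≤ k * l := Nat.mul_le_mul_right _ k.pos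
    push_cast
    omega)
  rw [coeff_smul, this, mul_zero]

theorem coeff_seriesSum_smul_X_eq_zero (b : ℕ+ → ℚ) {d : ℕ+ →₀ ℕ}
    (hd : ∀ i : ℕ+, d ≠ Finsupp.single i 1) :
    coeff d (seriesSum fun i : ℕ+ => b i • (X i : MvPowerSeries ℕ+ ℚ)) = 0 := by
  classical
  rw [(isGraded_smul_X b).coeff_seriesSum]
  exact Finset.sum_eq_zero fun i _ => by rw [coeff_smul, coeff_X, if_neg (hd i), mul_zero]

theorem coeff_single_seriesSum_smul_X (b : ℕ+ → ℚ) (i : ℕ+) :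
    coeff (Finsupp.single i 1) (seriesSum fun i : ℕ+ => b i • (X i : MvPowerSeries ℕ+ ℚ)) =
      b i := by
  classical
  change (∑ᶠ l : ℕ+, coeff (Finsupp.single i 1) (b l • (X l : MvPowerSeries ℕ+ ℚ))) = _
  rw [finsum_eq_single _ i]
  · simp [coeff_X]
  · intro l hl
    rw [coeff_smul, coeff_X, if_neg, mul_zero]
    intro h
    exact hl ((Finsupp.single_left_injective one_ne_zero) h).symm

/-- Only the monomials `p_i` occur in the linear series, so the sum over exponents in the
substitution collapses to a sum over `i`. -/
theorem subst_seriesSum_smul_X (b : ℕ+ → ℚ) {a : ℕ+ → MvPowerSeries ℕ+ ℚ} (ha : HasSubst a) :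
    subst a (seriesSum fun i : ℕ+ => b i • (X i : MvPowerSeries ℕ+ ℚ)) =
      seriesSum fun i => b i • a i := by
  classical
  ext m
  rw [coeff_subst ha]
  change _ = ∑ᶠ i : ℕ+, coeff m (b i • a i)
  have hinj : Function.Injective fun i : ℕ+ => Finsupp.single i 1 :=
    Finsupp.single_left_injective (one_ne_zero (α := ℕ))
  have hsupp : Function.support (fun d : ℕ+ →₀ ℕ => coeff d (seriesSum fun i : ℕ+ =>
      b i • (X i : MvPowerSeries ℕ+ ℚ)) • coeff m (d.prod fun s e => a s ^ e)) ⊆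
      Set.range fun i : ℕ+ => Finsupp.single i 1 := by
    intro d hd
    by_contra h
    refine hd ?_
    dsimp only
    rw [coeff_seriesSum_smul_X_eq_zero b fun i hi => h ⟨i, hi.symm⟩, zero_smul]
  rw [finsum_eq_finsum_comp hinj hsupp]
  refine finsum_congr fun i => ?_
  rw [coeff_single_seriesSum_smul_X, Finsupp.prod_single_index (by simp), pow_one, coeff_smul,
    smul_eq_mul]

/-! ### Expressing `p_k` through the dilations of `XSeries`. -/

theorem tilde_Sinh : tilde Sinh = (1 / 2 : ℚ) •
    (expSeries (seriesSum fun i : ℕ+ => ((-1) ^ ((i : ℕ) + 1) / (i : ℚ)) • X i)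
      - expSeries (seriesSum fun i : ℕ+ => (-1 / (i : ℚ)) • X i)) := by
  have ha : HasSubst fun i : ℕ+ => (-1 : ℚ) ^ ((i : ℕ) + 1) • (X i : MvPowerSeries ℕ+ ℚ) :=
    HasSubst.smul_X _
  rw [tilde, rescale_eq_subst]
  change subst (fun i : ℕ+ => (-1 : ℚ) ^ ((i : ℕ) + 1) • (X i : MvPowerSeries ℕ+ ℚ)) Sinh = _
  rw [Sinh, subst_smul ha, subst_sub ha,
    subst_expSeries ha (isGraded_smul_X _).constantCoeff_seriesSum,
    subst_expSeries ha (isGraded_smul_X _).constantCoeff_seriesSum,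
    subst_seriesSum_smul_X _ ha, subst_seriesSum_smul_X _ ha]
  have h1 : ∀ i : ℕ+, 1 / (i : ℚ) * (-1 : ℚ) ^ ((i : ℕ) + 1) = (-1) ^ ((i : ℕ) + 1) / (i : ℚ) :=
    fun i => by ring
  have h2 : ∀ i : ℕ+, (-1) ^ (i : ℕ) / (i : ℚ) * (-1 : ℚ) ^ ((i : ℕ) + 1) = -1 / (i : ℚ) := by
    intro i
    have : ((-1 : ℚ) ^ (i : ℕ)) * (-1) ^ (i : ℕ) = 1 := by rw [← mul_pow]; simp
    rw [pow_succ]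
    linear_combination (-1 / (i : ℚ)) * this
  simp only [smul_smul, h1, h2]

theorem X_eq_expSeries_sub (k : ℕ+) : (X k : MvPowerSeries ℕ+ ℚ) = (1 / 2 : ℚ) •
    (expSeries (seriesSum fun i : ℕ+ =>
        ((-1) ^ ((i : ℕ) + 1) / (i : ℚ)) • dilate (k * i) ArcsinhTilde)
      - expSeries (seriesSum fun i : ℕ+ => (-1 / (i : ℚ)) • dilate (k * i) ArcsinhTilde)) := by
  obtain ⟨h0, h1, -⟩ := arcsinhTilde_spec
  have ha : HasSubst fun j : ℕ+ => dilate (k * j) ArcsinhTilde := by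
    refine hasSubst_of_degGE k.pos fun s => ?_
    simpa using degGE_dilate_one h0 (k * s)
  have h2 := congrArg (dilate k) h1
  rw [dilate_X, mul_one, dilate_plethysm _ h0, tilde_Sinh, subst_smul ha, subst_sub ha,
    subst_expSeries ha (isGraded_smul_X _).constantCoeff_seriesSum,
    subst_expSeries ha (isGraded_smul_X _).constantCoeff_seriesSum,
    subst_seriesSum_smul_X _ ha, subst_seriesSum_smul_X _ ha] at h2
  exact h2.symm

/-- The even counterpart `∑_{j even} Arcsinh^∼[p_{kj}] / j` of `XSeries[p_k]`. -/
noncomputable def evenSeries (k : ℕ+) : MvPowerSeries ℕ+ ℚ :=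
  seriesSum fun j : ℕ+ => (if Even (j : ℕ) then 1 / (j : ℚ) else 0) • dilate (k * j) ArcsinhTilde

theorem XSeries_eq : XSeries = seriesSum fun j : ℕ+ =>
    (if Odd (j : ℕ) then 1 / (j : ℚ) else 0) • dilate (1 * j) ArcsinhTilde := by
  rw [XSeries]
  congr 1
  funext j
  split_ifs <;> simp [plethysm_eq_dilate]

theorem constantCoeff_XSeries : constantCoeff XSeries = 0 := by
  rw [XSeries_eq]
  exact (isGraded_smul_dilate _ arcsinhTilde_spec.1 1).constantCoeff_seriesSum

/-- `XSeries` is itself the plethysm of the linear series `∑_{j odd} p_j / j` with `ArcsinhTilde`,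
so dilating it only dilates the inner series. -/
theorem dilate_XSeries (k : ℕ+) : dilate k XSeries = seriesSum fun j : ℕ+ =>
    (if Odd (j : ℕ) then 1 / (j : ℚ) else 0) • dilate (k * j) ArcsinhTilde := by
  have h0 := arcsinhTilde_spec.1
  have h1 : XSeries = plethysm (seriesSum fun j : ℕ+ =>
      (if Odd (j : ℕ) then 1 / (j : ℚ) else 0) • X j) ArcsinhTilde := by
    rw [plethysm, subst_seriesSum_smul_X _ (hasSubst_dilate h0), XSeries_eq]
    simp only [one_mul]
  have ha : HasSubst fun j : ℕ+ => dilate (k * j) ArcsinhTilde := by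
    refine hasSubst_of_degGE k.pos fun s => ?_
    simpa using degGE_dilate_one h0 (k * s)
  rw [h1, dilate_plethysm _ h0, subst_seriesSum_smul_X _ ha]

/-- Put `j = 2i` in the sum over even `j`: the weight `2/j` becomes `1/i`, and the odd and even `i`
give the two summands. -/
theorem two_smul_evenSeries (k : ℕ+) :
    (2 : ℚ) • evenSeries k = dilate (2 * k) XSeries + evenSeries (2 * k) := by
  have h0 := arcsinhTilde_spec.1
  rw [dilate_XSeries, evenSeries, evenSeries, ← (isGraded_smul_dilate _ h0 (2 * k)).seriesSum_add
    (isGraded_smul_dilate _ h0 (2 * k)), ← seriesSum_smul _ (isGraded_smul_dilate _ h0 k)]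
  ext m
  change (∑ᶠ j : ℕ+, coeff m _) = ∑ᶠ j : ℕ+, coeff m _
  have hinj : Function.Injective fun j : ℕ+ => 2 * j := mul_right_injective 2
  have hsupp : Function.support (fun j : ℕ+ => coeff m ((2 : ℚ) •
      (if Even (j : ℕ) then 1 / (j : ℚ) else 0) • dilate (k * j) ArcsinhTilde)) ⊆
      Set.range fun j : ℕ+ => 2 * j := by
    intro j hj
    by_contra h
    refine hj ?_
    dsimp only
    rw [if_neg, zero_smul, smul_zero, map_zero]
    rintro ⟨i, hi⟩
    have hi0 : 0 < i := by have := j.pos; omega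
    exact h ⟨⟨i, hi0⟩, PNat.eq (by rw [hi, ← two_mul]; rfl)⟩
  rw [finsum_eq_finsum_comp hinj hsupp]
  refine finsum_congr fun j => ?_
  have h1 : (if Odd (j : ℕ) then 1 / (j : ℚ) else 0) + (if Even (j : ℕ) then 1 / (j : ℚ) else 0) =
      1 / (j : ℚ) := by
    rcases Nat.even_or_odd (j : ℕ) with h | h
    · rw [if_pos h, if_neg (by simpa using h), zero_add]
    · rw [if_pos h, if_neg (by simpa using h), add_zero]
  rw [← add_smul, h1, if_pos (by simp), smul_smul, show k * (2 * j) = 2 * k * j by ring]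
  congr 2
  push_cast
  field_simp

/-- The two exponents have the same even part, and their odd parts differ by a sign. -/
theorem X_eq_expSeries_dilate (k : ℕ+) : (X k : MvPowerSeries ℕ+ ℚ) = (1 / 2 : ℚ) •
    (expSeries (dilate k XSeries - evenSeries k)
      - expSeries (-dilate k XSeries - evenSeries k)) := by
  have h0 := arcsinhTilde_spec.1
  rw [X_eq_expSeries_sub, dilate_XSeries, evenSeries, sub_eq_add_neg (seriesSum _),
    sub_eq_add_neg (-seriesSum _), ← neg_one_smul ℚ (seriesSum _), ← neg_one_smul ℚ (seriesSum _),
    ← seriesSum_smul _ (isGraded_smul_dilate _ h0 k), ← seriesSum_smul _ (isGraded_smul_dilate _ h0 k)]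
  simp only [smul_smul]
  rw [← (isGraded_smul_dilate _ h0 k).seriesSum_add (isGraded_smul_dilate _ h0 k),
    ← (isGraded_smul_dilate _ h0 k).seriesSum_add (isGraded_smul_dilate _ h0 k)]
  simp only [← add_smul]
  have h1 : ∀ i : ℕ+, (-1 : ℚ) ^ ((i : ℕ) + 1) / (i : ℚ) =
      (if Odd (i : ℕ) then 1 / (i : ℚ) else 0) + -1 * (if Even (i : ℕ) then 1 / (i : ℚ) else 0) := by
    intro i
    rcases Nat.even_or_odd (i : ℕ) with h | h
    · rw [if_pos h, if_neg (by simpa using h), h.add_one.neg_one_pow]; ring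
    · rw [if_pos h, if_neg (by simpa using h), h.add_one.neg_one_pow]; ring
  have h2 : ∀ i : ℕ+, (-1 : ℚ) / (i : ℚ) = -1 * (if Odd (i : ℕ) then 1 / (i : ℚ) else 0) +
      -1 * (if Even (i : ℕ) then 1 / (i : ℚ) else 0) := by
    intro i
    rcases Nat.even_or_odd (i : ℕ) with h | h
    · rw [if_pos h, if_neg (by simpa using h)]; ring
    · rw [if_pos h, if_neg (by simpa using h)]; ring
  simp only [h1, h2]

/-! ### Dyadic weights, the combinatorics of `o_l`. -/

/-- `∑_{k ≥ 1, 2^k ∣ l} 2^{-k} l f(2^{-k} l)`. -/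
noncomputable def dyadicWeight (f : ℕ → ℕ) (l : ℕ) : ℕ :=
  ∑ k ∈ (Finset.Icc 1 l).filter (fun k => 2 ^ k ∣ l), (l / 2 ^ k) * f (l / 2 ^ k)

theorem dyadicWeight_of_odd (f : ℕ → ℕ) {l : ℕ} (hl : Odd l) : dyadicWeight f l = 0 := by
  refine Finset.sum_eq_zero fun k hk => ?_
  simp only [Finset.mem_filter, Finset.mem_Icc] at hk
  exact absurd ((dvd_pow_self 2 (by omega)).trans hk.2) hl.not_two_dvd_nat

theorem dyadicWeight_two_mul (f : ℕ → ℕ) {l : ℕ} (hl : 0 < l) :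
    dyadicWeight f (2 * l) = l * f l + dyadicWeight f l := by
  have h : (Finset.Icc 1 (2 * l)).filter (fun k => 2 ^ k ∣ 2 * l) =
      insert 1 (((Finset.Icc 1 l).filter (fun k => 2 ^ k ∣ l)).image Nat.succ) := by
    ext k
    simp only [Finset.mem_filter, Finset.mem_Icc, Finset.mem_insert, Finset.mem_image]
    constructor
    · rintro ⟨⟨h1, -⟩, h3⟩
      rcases Nat.lt_or_ge 1 k with h | h
      · obtain ⟨j, rfl⟩ : ∃ j, k = j + 1 := ⟨k - 1, by omega⟩
        rw [pow_succ', Nat.mul_dvd_mul_iff_left two_pos] at h3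
        have := Nat.le_of_dvd hl h3
        -- The bound `j < 2 ^ j ≤ l` shows that the upper limit of the index interval excludes
        -- nothing.
        have := Nat.lt_two_pow_self (n := j)
        exact Or.inr ⟨j, ⟨⟨by omega, by omega⟩, h3⟩, rfl⟩
      · exact Or.inl (by omega)
    · rintro (rfl | ⟨j, ⟨⟨h1, h2⟩, h3⟩, rfl⟩)
      · exact ⟨⟨le_rfl, by omega⟩, by simp⟩
      · exact ⟨⟨by omega, by omega⟩, by
          rw [Nat.succ_eq_add_one, pow_succ']; exact Nat.mul_dvd_mul_left 2 h3⟩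
  rw [dyadicWeight, h, Finset.sum_insert, Finset.sum_image Nat.succ_injective.injOn]
  · congr 1
    · simp
    · refine Finset.sum_congr rfl fun k _ => ?_
      rw [Nat.succ_eq_add_one, pow_succ', Nat.mul_div_mul_left _ _ two_pos]
  · simp only [Finset.mem_image, Finset.mem_filter, Finset.mem_Icc, not_exists, not_and]
    rintro j ⟨⟨h1, -⟩, -⟩
    omega

theorem dyadicWeight_add (f g : ℕ → ℕ) (l : ℕ) :
    dyadicWeight (fun i => f i + g i) l = dyadicWeight f l + dyadicWeight g l := by
  simp only [dyadicWeight, mul_add, Finset.sum_add_distrib]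

theorem dyadicWeight_eq_zero {f : ℕ → ℕ} {l : ℕ} (h : ∀ i, 0 < i → i < l → f i = 0) :
    dyadicWeight f l = 0 := by
  refine Finset.sum_eq_zero fun k hk => ?_
  simp only [Finset.mem_filter, Finset.mem_Icc] at hk
  have hl : 0 < l := by omega
  rw [h, mul_zero]
  · exact Nat.div_pos (Nat.le_of_dvd hl hk.2) (by positivity)
  · exact Nat.div_lt_self hl (Nat.one_lt_two_pow (by omega))

/-- The exponents of a monomial in the `p_i`, as a function on `ℕ`. -/
noncomputable def exponent (m : ℕ+ →₀ ℕ) (i : ℕ) : ℕ := if h : 0 < i then m ⟨i, h⟩ else 0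

theorem exponent_coe (m : ℕ+ →₀ ℕ) (i : ℕ+) : exponent m i = m i := by
  rw [exponent, dif_pos i.pos]; rfl

theorem exponent_add (m m' : ℕ+ →₀ ℕ) :
    exponent (m + m') = fun i => exponent m i + exponent m' i := by
  funext i
  unfold exponent
  split_ifs <;> rfl

/-- The contribution of one cycle of length `k` to the dyadic weight at `l`. -/
noncomputable def shiftWeight (k l : ℕ+) : ℕ := dyadicWeight (exponent (Finsupp.single k 1)) l

theorem exponent_single (k : ℕ+) (i : ℕ) :
    exponent (Finsupp.single k 1) i = if i = k then 1 else 0 := by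
  classical
  rcases Nat.eq_zero_or_pos i with rfl | hi
  · rw [exponent, dif_neg (by simp), if_neg k.pos.ne]
  · lift i to ℕ+ using hi
    rw [exponent_coe, Finsupp.single_apply]
    simp only [PNat.coe_inj, eq_comm]

theorem shiftWeight_eq_zero {k l : ℕ+} (h : l ≤ k) : shiftWeight k l = 0 := by
  refine dyadicWeight_eq_zero fun i _ hi => ?_
  have : (l : ℕ) ≤ k := h
  rw [exponent_single, if_neg (by omega)]

/-- The weight at `l` is `k` when `l = 2^i k` with `i ≥ 1`, and zero otherwise. The recursion is the
counterpart of `two_smul_evenSeries`. -/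
theorem two_mul_dyadicWeight_single (k : ℕ+) (l : ℕ) (hl : 0 < l) :
    2 * dyadicWeight (exponent (Finsupp.single k 1)) l =
      (if l = 2 * k then 2 * (k : ℕ) else 0) +
        dyadicWeight (exponent (Finsupp.single (2 * k) 1)) l := by
  induction l using Nat.strong_induction_on with
  | _ l ih =>
    rcases Nat.even_or_odd l with h | h
    · obtain ⟨i, rfl⟩ := h.two_dvd
      have hi : 0 < i := by omega
      rw [dyadicWeight_two_mul _ hi, dyadicWeight_two_mul _ hi, mul_add, ih i (by omega) hi,
        exponent_single, exponent_single]
      have h2 : ((2 * k : ℕ+) : ℕ) = 2 * k := rfl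
      rw [h2]
      split_ifs <;> omega
    · rw [dyadicWeight_of_odd _ h, dyadicWeight_of_odd _ h, if_neg]
      rintro rfl
      exact Nat.not_odd_iff_even.2 (even_two_mul _) h

theorem two_mul_shiftWeight (k l : ℕ+) : 2 * shiftWeight k l =
    (if l = 2 * k then 2 * (k : ℕ) else 0) + shiftWeight (2 * k) l := by
  rw [shiftWeight, two_mul_dyadicWeight_single k l l.pos, shiftWeight]
  congr 1
  simp only [← PNat.coe_inj]
  rfl

theorem dyadicWeight_exponent_add_single (m : ℕ+ →₀ ℕ) (k l : ℕ+) :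
    dyadicWeight (exponent (m + Finsupp.single k 1)) l =
      dyadicWeight (exponent m) l + shiftWeight k l := by
  rw [exponent_add, dyadicWeight_add, shiftWeight]

/-! ### The difference equation for `exp(∑ c_l X[p_l] / l)`. -/

section LogSeries

variable {K : Type*} [CommRing K] [Algebra ℚ K]

/-- The series `∑ c_l X[p_l] / l`. -/
noncomputable def logSeries (c : ℕ+ → K) : MvPowerSeries ℕ+ K :=
  seriesSum fun l : ℕ+ => (1 / ((l : ℕ) : ℚ)) • c l •
    (plethysm XSeries (X l)).map (algebraMap ℚ K)

theorem isGraded_logSeries (c : ℕ+ → K) : IsGraded fun l : ℕ+ => (1 / ((l : ℕ) : ℚ)) • c l •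
    (plethysm XSeries (X l)).map (algebraMap ℚ K) := by
  intro l m hm
  have h := degGE_dilate_one constantCoeff_XSeries l m (by omega)
  dsimp only
  rw [plethysm_eq_dilate]
  change (1 / ((l : ℕ) : ℚ)) • (c l * algebraMap ℚ K (coeff m (dilate l XSeries))) = 0
  rw [h, map_zero, mul_zero, smul_zero]

theorem constantCoeff_logSeries (c : ℕ+ → K) : constantCoeff (logSeries c) = 0 :=
  (isGraded_logSeries c).constantCoeff_seriesSum

theorem logSeries_add (c d : ℕ+ → K) : logSeries (c + d) = logSeries c + logSeries d := by
  rw [logSeries, logSeries, logSeries,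
    ← (isGraded_logSeries c).seriesSum_add (isGraded_logSeries d)]
  simp only [Pi.add_apply, add_smul, smul_add]

theorem logSeries_smul (r : K) (c : ℕ+ → K) : logSeries (r • c) = r • logSeries c := by
  rw [logSeries, logSeries, ← seriesSum_smul r (isGraded_logSeries c)]
  simp only [Pi.smul_apply, smul_eq_mul, mul_smul]
  congr 1
  funext l
  rw [smul_comm]

theorem logSeries_neg (c : ℕ+ → K) : logSeries (-c) = -logSeries c := by
  rw [← neg_one_smul K c, logSeries_smul, neg_one_smul]

theorem logSeries_single (k : ℕ+) : logSeries (Pi.single k ((k : ℕ) : K)) =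
    (dilate k XSeries).map (algebraMap ℚ K) := by
  ext m
  change (∑ᶠ l : ℕ+, coeff m _) = _
  rw [finsum_eq_single _ k]
  · have hk : (((k : ℕ) : ℚ)) ≠ 0 := by have := k.pos; positivity
    rw [Pi.single_eq_same, plethysm_eq_dilate, Nat.cast_smul_eq_nsmul, ← Nat.cast_smul_eq_nsmul ℚ,
      smul_smul, one_div_mul_cancel hk, one_smul]
  · intro l hl
    rw [Pi.single_eq_of_ne hl, zero_smul, smul_zero, map_zero]

theorem eq_zero_of_two_mul {x : K} (h : 2 * x = 0) : x = 0 := by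
  have : ((1 / 2 : ℚ) * 2) • x = 0 := by
    rw [mul_smul, show (2 : ℚ) • x = 2 * x by rw [two_smul, two_mul], h, smul_zero]
  simpa using this

theorem coeff_evenSeries_eq_zero {k : ℕ+} {m : ℕ+ →₀ ℕ} (hm : pDegree m < k) :
    coeff m (evenSeries k) = 0 := by
  have h0 := arcsinhTilde_spec.1
  rw [evenSeries, (isGraded_smul_dilate _ h0 k).coeff_seriesSum]
  refine Finset.sum_eq_zero fun l _ => ?_
  have : (k : ℕ) * 1 ≤ k * l := Nat.mul_le_mul_left _ l.pos
  rw [coeff_smul, degGE_dilate_one h0 (k * l) m (by push_cast; omega), mul_zero]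

theorem coeff_logSeries_shiftWeight_eq_zero {k : ℕ+} {m : ℕ+ →₀ ℕ} (hm : pDegree m < k) :
    coeff m (logSeries fun l => (shiftWeight k l : K)) = 0 := by
  rw [logSeries, (isGraded_logSeries _).coeff_seriesSum]
  refine Finset.sum_eq_zero fun l _ => ?_
  rcases le_or_gt l k with h | h
  · rw [shiftWeight_eq_zero h, Nat.cast_zero, zero_smul, smul_zero, map_zero]
  · exact isGraded_logSeries (fun l => (shiftWeight k l : K)) l m (hm.trans (PNat.coe_lt_coe _ _ |>.2 h))

/-- Both families satisfy `2 A_k = X[p_{2k}] + A_{2k}` and have no terms of `p`-degree below `k`;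
these two facts determine `A_k`. -/
theorem logSeries_shiftWeight (k : ℕ+) : logSeries (fun l => (shiftWeight k l : K)) =
    (evenSeries k).map (algebraMap ℚ K) := by
  have hrec : ∀ k : ℕ+, 2 * logSeries (fun l => (shiftWeight k l : K)) =
      (dilate (2 * k) XSeries).map (algebraMap ℚ K) +
        logSeries fun l => (shiftWeight (2 * k) l : K) := by
    intro k
    rw [← logSeries_single, ← logSeries_add, two_mul, ← logSeries_add]
    refine congrArg (logSeries (K := K)) ?_
    funext l
    have h := congrArg (Nat.cast (R := K)) (two_mul_shiftWeight k l)
    push_cast at h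
    rw [Pi.add_apply, Pi.add_apply, ← two_mul, h, Pi.single_apply]
    congr 1
    split_ifs <;> simp
  have hrec' : ∀ k : ℕ+, 2 * (evenSeries k).map (algebraMap ℚ K) =
      (dilate (2 * k) XSeries).map (algebraMap ℚ K) +
        (evenSeries (2 * k)).map (algebraMap ℚ K) := by
    intro k
    rw [← map_add, ← two_smul_evenSeries, two_smul, map_add, two_mul]
  ext m
  -- This quantity strictly decreases when `k` is doubled, as long as `k ≤ pDegree m`.
  generalize hn : pDegree m + 1 - k = n
  induction n using Nat.strong_induction_on generalizing k with
  | _ n ih =>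
    rcases Nat.lt_or_ge (pDegree m) k with h | h
    · rw [coeff_logSeries_shiftWeight_eq_zero h, coeff_map, coeff_evenSeries_eq_zero h, map_zero]
    · have h2 : ((2 * k : ℕ+) : ℕ) = 2 * k := rfl
      have hk := k.pos
      have h1 := ih (pDegree m + 1 - (2 * k : ℕ+)) (by omega) (2 * k) rfl
      have h3 := congrArg (coeff m) (hrec k)
      have h4 := congrArg (coeff m) (hrec' k)
      rw [two_mul, map_add, map_add] at h3 h4
      rw [← sub_eq_zero]
      refine eq_zero_of_two_mul (K := K) ?_
      linear_combination h3 - h4 + h1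

theorem expSeries_logSeries_add (c d : ℕ+ → K) : expSeries (logSeries (c + d)) =
    expSeries (logSeries c) * expSeries (logSeries d) := by
  rw [logSeries_add, expSeries_add (constantCoeff_logSeries c) (constantCoeff_logSeries d)]

theorem constantCoeff_evenSeries (k : ℕ+) : constantCoeff (evenSeries k) = 0 :=
  (isGraded_smul_dilate _ arcsinhTilde_spec.1 k).constantCoeff_seriesSum

theorem constantCoeff_dilate_XSeries (k : ℕ+) : constantCoeff (dilate k XSeries) = 0 := by
  rw [dilate_XSeries]
  exact (isGraded_smul_dilate _ arcsinhTilde_spec.1 k).constantCoeff_seriesSum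

theorem two_mul_X_eq_expSeries_logSeries (k : ℕ+) : 2 * (X k : MvPowerSeries ℕ+ K) =
    expSeries (logSeries (Pi.single k ((k : ℕ) : K) + -fun l => (shiftWeight k l : K)))
      - expSeries (logSeries (-Pi.single k ((k : ℕ) : K) + -fun l => (shiftWeight k l : K))) := by
  have h1 : (2 : ℚ) • (X k : MvPowerSeries ℕ+ ℚ) =
      expSeries (dilate k XSeries - evenSeries k)
        - expSeries (-dilate k XSeries - evenSeries k) := by
    rw [X_eq_expSeries_dilate, smul_smul, mul_one_div_cancel two_ne_zero, one_smul]
  have h2 := congrArg (MvPowerSeries.map (algebraMap ℚ K)) h1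
  rw [two_smul, map_add, map_X, ← two_mul, map_sub, map_expSeries, map_expSeries, map_sub, map_sub,
    map_neg, ← logSeries_shiftWeight, ← logSeries_single] at h2
  · simp only [h2, logSeries_add, logSeries_neg, sub_eq_add_neg]
  · rw [map_sub, map_neg, constantCoeff_dilate_XSeries, constantCoeff_evenSeries]; simp
  · rw [map_sub, constantCoeff_dilate_XSeries, constantCoeff_evenSeries]; simp

/-- Multiplying the formula for `2 p_k` by the exponential on the right cancels the shift by
`shiftWeight k` in both terms. -/
theorem expSeries_logSeries_sub (c : ℕ+ → K) (k : ℕ+) :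
    expSeries (logSeries (c + Pi.single k ((k : ℕ) : K))) -
      expSeries (logSeries (c + -Pi.single k ((k : ℕ) : K))) =
    2 * X k * expSeries (logSeries (c + fun l => (shiftWeight k l : K))) := by
  rw [two_mul_X_eq_expSeries_logSeries, sub_mul, ← expSeries_logSeries_add,
    ← expSeries_logSeries_add]
  congr 3 <;> abel

theorem coeff_expSeries_logSeries_sub (c : ℕ+ → K) (k : ℕ+) (m : ℕ+ →₀ ℕ) :
    coeff (m + Finsupp.single k 1) (expSeries (logSeries (c + Pi.single k ((k : ℕ) : K)))) -
      coeff (m + Finsupp.single k 1) (expSeries (logSeries (c + -Pi.single k ((k : ℕ) : K)))) =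
    2 * coeff m (expSeries (logSeries (c + fun l => (shiftWeight k l : K)))) := by
  rw [← map_sub, expSeries_logSeries_sub, mul_assoc, two_mul, map_add, two_mul, add_comm m, X_def,
    coeff_add_monomial_mul, one_mul]

theorem coeff_expSeries_logSeries_sub_of_eq_zero (c : ℕ+ → K) {k : ℕ+} {m : ℕ+ →₀ ℕ}
    (hm : m k = 0) :
    coeff m (expSeries (logSeries (c + Pi.single k ((k : ℕ) : K)))) -
      coeff m (expSeries (logSeries (c + -Pi.single k ((k : ℕ) : K)))) = 0 := by
  classical
  rw [← map_sub, expSeries_logSeries_sub, mul_assoc, two_mul, map_add, X_def, coeff_monomial_mul,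
    if_neg, add_zero]
  intro h
  have := h k
  simp [hm] at this

theorem exists_polynomial_coeff_expSeries_logSeries (c : ℕ+ → K) (k : ℕ+) (m : ℕ+ →₀ ℕ) :
    ∃ P : Polynomial K, ∀ t : K,
      coeff m (expSeries (logSeries (c + t • Pi.single k 1))) = P.eval t := by
  obtain ⟨P, hP⟩ := exists_polynomial_coeff_expSeries (constantCoeff_logSeries c)
    (constantCoeff_logSeries (Pi.single k (1 : K))) m
  exact ⟨P, fun t => by rw [logSeries_add, logSeries_smul, hP]⟩

theorem pDegree_mono {m m' : ℕ+ →₀ ℕ} (h : m' ≤ m) : pDegree m' ≤ pDegree m := by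
  obtain ⟨d, rfl⟩ := exists_add_of_le h
  rw [pDegree_add]
  omega

/-- Parameters outside `indexBound m` only contribute in `p`-degrees above that of `m`, so `c` may
be replaced by zero. -/
theorem coeff_expSeries_logSeries_of_eq_zero {c : ℕ+ → K} {m : ℕ+ →₀ ℕ}
    (hc : ∀ l ∈ indexBound m, c l = 0) :
    coeff m (expSeries (logSeries c)) = coeff m (1 : MvPowerSeries ℕ+ K) := by
  rw [← expSeries_zero]
  refine coeff_expSeries_congr (constantCoeff_logSeries c) (map_zero _) fun m' hm' => ?_
  rw [map_zero, logSeries, (isGraded_logSeries c).coeff_seriesSum]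
  refine Finset.sum_eq_zero fun l hl => ?_
  rw [hc l, zero_smul, smul_zero, map_zero]
  rw [indexBound, Finset.mem_Iic, ← PNat.coe_le_coe, Nat.succPNat_coe] at hl ⊢
  have := pDegree_mono hm'
  omega

end LogSeries

end PowerSum

/-! ### The factors of the closed formula. -/

namespace BijChar

variable {K : Type*} [CommRing K]

theorem charFactor_zero (c : K) (o l : ℕ) : charFactor c o l 0 = 1 := if_pos rfl

/-- Put `y = c + o`. For `r ≥ 1` both terms on the left contain the inner product `Q` of `charFactor
c o l r`, and what remains is `(y + l)(y + l r) - (y - l)(y - l r) = 2 (r + 1) l y`. For `r = 0` the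
convention that the factor is `1` makes the identity hold. -/
theorem charFactor_add_sub (c : K) (o l r : ℕ) :
    charFactor (c + l) o l (r + 1) - charFactor (c + -l) o l (r + 1) =
      2 * ((r : K) + 1) * l * charFactor c o l r := by
  rcases r with _ | r
  · simp only [charFactor]
    simp
    ring
  · simp only [charFactor, Nat.add_eq_zero_iff, one_ne_zero, and_false, if_false,
      Nat.add_sub_cancel]
    -- The common product appears after removing the first factor of one product and the last factor
    -- of the other.
    rw [Finset.prod_range_succ', Finset.prod_range_succ (n := r)]
    have h1 : ∀ i : ℕ, c + l + o + l * (((r + 1 + 1 : ℕ) : K) - 2 - 2 * ((i + 1 : ℕ) : K)) =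
        c + o + l * (((r + 1 : ℕ) : K) - 2 - 2 * i) := fun i => by push_cast; ring
    have h2 : ∀ i : ℕ, c + -l + o + l * (((r + 1 + 1 : ℕ) : K) - 2 - 2 * (i : K)) =
        c + o + l * (((r + 1 : ℕ) : K) - 2 - 2 * i) := fun i => by push_cast; ring
    simp only [h1, h2]
    generalize ∏ i ∈ Finset.range r, (c + o + l * (((r + 1 : ℕ) : K) - 2 - 2 * (i : K))) = Q
    push_cast
    ring

theorem exists_polynomial_charFactor (a b : K) (o l r : ℕ) :
    ∃ P : Polynomial K, ∀ t : K, charFactor (a + t * b) o l r = P.eval t := by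
  set Y : Polynomial K := Polynomial.C a + Polynomial.X * Polynomial.C b + Polynomial.C (o : K)
    with hY
  refine ⟨if r = 0 then 1 else Y * ∏ i ∈ Finset.range (r - 1),
    (Y + Polynomial.C (l * ((r : K) - 2 - 2 * i))), fun t => ?_⟩
  rw [charFactor]
  split_ifs
  · simp
  · simp only [hY, Polynomial.eval_mul, Polynomial.eval_add, Polynomial.eval_C, Polynomial.eval_X,
      Polynomial.eval_prod]

/-- Only `c + o` enters, so a shift of the parameter can be traded for a shift of `o`. -/
theorem charFactor_add_natCast (c : K) (w o l r : ℕ) :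
    charFactor (c + w) o l r = charFactor c (o + w) l r := by
  have : c + w + o = c + ((o + w : ℕ) : K) := by push_cast; ring
  simp only [charFactor, this]

end BijChar

/-! ### The closed formula and its difference equation. -/

namespace PowerSum

open BijChar

variable {K : Type*} [CommRing K] [Algebra ℚ K]

/-- The order `l ^ r r!` of the automorphism group of `r` cycles of length `l`. -/
noncomputable def cycleAut (l r : ℕ) : ℚ := (l : ℚ) ^ r * r.factorial

/-- The closed formula for the coefficients of `exp(∑ c_l X[p_l] / l)`. -/
noncomputable def closedCoeff (m : ℕ+ →₀ ℕ) (c : ℕ+ → K) : K :=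
  ∏ l ∈ m.support, (1 / cycleAut l (m l)) •
    charFactor (c l) (dyadicWeight (exponent m) l) l (m l)

theorem closedCoeff_eq_prod {m : ℕ+ →₀ ℕ} {s : Finset ℕ+} (hs : m.support ⊆ s) (c : ℕ+ → K) :
    closedCoeff m c = ∏ l ∈ s, (1 / cycleAut l (m l)) •
      charFactor (c l) (dyadicWeight (exponent m) l) l (m l) := by
  refine Finset.prod_subset hs fun l _ hl => ?_
  rw [Finsupp.notMem_support_iff.1 hl, charFactor_zero, cycleAut]
  simp

/-- At `l = k` this is `charFactor_add_sub`, whose factor `(r + 1) k` is the ratio of the two values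
of `cycleAut`. At `l ≠ k` the extra `k`-cycle changes `o_l` by `shiftWeight k l`, which is absorbed
into the parameter. -/
theorem closedCoeff_sub (c : ℕ+ → K) (k : ℕ+) (m : ℕ+ →₀ ℕ) :
    closedCoeff (m + Finsupp.single k 1) (c + Pi.single k ((k : ℕ) : K)) -
      closedCoeff (m + Finsupp.single k 1) (c + -Pi.single k ((k : ℕ) : K)) =
    2 * closedCoeff m (c + fun l => (shiftWeight k l : K)) := by
  classical
  set s := insert k m.support
  have hk : k ∈ s := Finset.mem_insert_self _ _
  have hs' : m.support ⊆ s := Finset.subset_insert k m.support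
  have hs : (m + Finsupp.single k 1).support ⊆ s := by
    intro l hl
    by_contra h
    rw [Finset.mem_insert, not_or, Finsupp.notMem_support_iff] at h
    rw [Finsupp.mem_support_iff, Finsupp.add_apply, h.2, Finsupp.single_eq_of_ne h.1] at hl
    exact hl rfl
  rw [closedCoeff_eq_prod hs, closedCoeff_eq_prod hs,
    closedCoeff_eq_prod hs', ← Finset.mul_prod_erase _ _ hk,
    ← Finset.mul_prod_erase _ _ hk, ← Finset.mul_prod_erase _ _ hk]
  have h1 : ∀ d : ℕ+ → K, (∀ l, l ≠ k → d l = 0) → ∀ l ∈ s.erase k,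
      (1 / cycleAut l ((m + Finsupp.single k 1 : ℕ+ →₀ ℕ) l)) • charFactor ((c + d) l)
        (dyadicWeight (exponent (m + Finsupp.single k 1)) l) l
          ((m + Finsupp.single k 1 : ℕ+ →₀ ℕ) l) =
      (1 / cycleAut l (m l)) • charFactor ((c + fun l => (shiftWeight k l : K)) l)
        (dyadicWeight (exponent m) l) l (m l) := by
    intro d hd l hl
    have hlk := Finset.ne_of_mem_erase hl
    rw [Finsupp.add_apply, Finsupp.single_eq_of_ne hlk, add_zero, Pi.add_apply, hd l hlk,
      add_zero, Pi.add_apply, charFactor_add_natCast, dyadicWeight_exponent_add_single]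
  rw [Finset.prod_congr rfl (h1 _ fun l hl => Pi.single_eq_of_ne hl _),
    Finset.prod_congr rfl (h1 _ fun l hl => by rw [Pi.neg_apply, Pi.single_eq_of_ne hl, neg_zero]),
    ← sub_mul, ← mul_assoc]
  congr 1
  rw [dyadicWeight_exponent_add_single, shiftWeight_eq_zero le_rfl, add_zero, Finsupp.add_apply,
    Finsupp.single_eq_same, ← smul_sub]
  simp only [Pi.add_apply, Pi.neg_apply, Pi.single_eq_same]
  rw [charFactor_add_sub, shiftWeight_eq_zero le_rfl, Nat.cast_zero, add_zero, mul_smul_comm]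
  have hk0 : ((k : ℕ) : ℚ) ≠ 0 := by have := k.pos; positivity
  have h3 : ∀ x : K, 2 * (((m k : ℕ) : K) + 1) * ((k : ℕ) : K) * x =
      (((m k : ℕ) : ℚ) + 1) • ((k : ℕ) : ℚ) • (2 * x) := by
    intro x
    rw [Nat.cast_smul_eq_nsmul, nsmul_eq_mul, add_smul, one_smul, Nat.cast_smul_eq_nsmul,
      nsmul_eq_mul]
    ring
  rw [h3, smul_smul, smul_smul]
  congr 1
  rw [cycleAut, cycleAut, Nat.factorial_succ, pow_succ]
  have : (((m k : ℕ) : ℚ) + 1) ≠ 0 := by positivity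
  have : ((m k).factorial : ℚ) ≠ 0 := by positivity
  push_cast
  field_simp

theorem closedCoeff_congr {m : ℕ+ →₀ ℕ} {c d : ℕ+ → K} (h : ∀ l ∈ m.support, c l = d l) :
    closedCoeff m c = closedCoeff m d :=
  Finset.prod_congr rfl fun l hl => by rw [h l hl]

theorem closedCoeff_add_eq_of_eq_zero (c d : ℕ+ → K) {k : ℕ+} {m : ℕ+ →₀ ℕ} (hm : m k = 0)
    (hd : ∀ l, l ≠ k → d l = 0) : closedCoeff m (c + d) = closedCoeff m c := by
  refine closedCoeff_congr fun l hl => ?_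
  have : l ≠ k := by
    rintro rfl
    exact Finsupp.mem_support_iff.1 hl hm
  rw [Pi.add_apply, hd l this, add_zero]

theorem exists_polynomial_closedCoeff (c : ℕ+ → K) (k : ℕ+) (m : ℕ+ →₀ ℕ) :
    ∃ P : Polynomial K, ∀ t : K, closedCoeff m (c + t • Pi.single k 1) = P.eval t := by
  choose P hP using fun l : ℕ+ => exists_polynomial_charFactor (c l)
    ((Pi.single k 1 : ℕ+ → K) l) (dyadicWeight (exponent m) l) l (m l)
  refine ⟨∏ l ∈ m.support, (1 / cycleAut l (m l)) • P l, fun t => ?_⟩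
  rw [Polynomial.eval_prod]
  refine Finset.prod_congr rfl fun l _ => ?_
  rw [Polynomial.eval_smul, ← hP]
  rfl

theorem closedCoeff_eq_zero {m : ℕ+ →₀ ℕ} (hm : m ≠ 0) {c : ℕ+ → K}
    (hc : ∀ l ∈ m.support, c l = 0) : closedCoeff m c = 0 := by
  have hne : m.support.Nonempty := Finsupp.support_nonempty_iff.2 hm
  -- For the shortest cycle length `l` there is nothing to contribute to `o_l`, so the leading
  -- factor `c_l + o_l` vanishes.
  have hmem := m.support.min'_mem hne
  refine Finset.prod_eq_zero hmem ?_
  rw [dyadicWeight_eq_zero, charFactor, if_neg (Finsupp.mem_support_iff.1 hmem), hc _ hmem,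
    Nat.cast_zero, add_zero, zero_mul, smul_zero]
  intro i hi hlt
  lift i to ℕ+ using hi
  rw [exponent_coe]
  by_contra h
  have := m.support.min'_le i (Finsupp.mem_support_iff.2 h)
  exact absurd hlt (not_lt.2 this)

/-! ### Polynomial and periodic implies constant; equality of the coefficients. -/

/-- A polynomial over a `ℚ`-algebra that vanishes at all multiples of `q` is zero. -/
theorem polynomial_eq_zero_of_eval_mul {P : Polynomial K} {q : ℕ} (hq : q ≠ 0)
    (h : ∀ n : ℕ, P.eval ((n : K) * q) = 0) : P = 0 := by
  ext i
  -- Since `K` may have zero divisors, counting roots in `K` is not available. A `ℚ`-linear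
  -- functional applied to the coefficients gives a rational polynomial with infinitely many roots.
  rw [Polynomial.coeff_zero, ← Module.forall_dual_apply_eq_zero_iff ℚ]
  intro φ
  let Q : Polynomial ℚ := ∑ i ∈ Finset.range (P.natDegree + 1),
    Polynomial.monomial i (φ (P.coeff i))
  have hQ : ∀ n : ℕ, Q.eval ((n : ℚ) * q) = 0 := by
    intro n
    have h1 := congrArg φ (h n)
    rw [Polynomial.eval_eq_sum_range, map_sum, map_zero] at h1
    rw [← h1]
    simp only [Q, Polynomial.eval_finsetSum, Polynomial.eval_monomial]
    refine Finset.sum_congr rfl fun i _ => ?_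
    have : ((n : K) * q) ^ i = ((n * q) ^ i : ℕ) := by push_cast; rfl
    rw [this, mul_comm (P.coeff i), ← nsmul_eq_mul ((n * q) ^ i), map_nsmul, nsmul_eq_mul]
    push_cast
    ring
  have hQ0 : Q = 0 := by
    refine Polynomial.eq_zero_of_infinite_isRoot Q
      ((Set.infinite_range_of_injective (f := fun n : ℕ => (n : ℚ) * q) ?_).mono ?_)
    · intro a b hab
      have : (q : ℚ) ≠ 0 := by positivity
      exact Nat.cast_injective (mul_right_cancel₀ this hab)
    · rintro _ ⟨n, rfl⟩
      exact hQ n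
  have h2 := congrArg (Polynomial.coeff · i) hQ0
  simp only [Q, Polynomial.finsetSum_coeff, Polynomial.coeff_monomial, Polynomial.coeff_zero,
    Finset.sum_ite_eq', Finset.mem_range] at h2
  by_cases hi : i < P.natDegree + 1
  · rwa [if_pos hi] at h2
  · rw [Polynomial.coeff_eq_zero_of_natDegree_lt (by omega), map_zero]

/-- A function on `ℕ+ → K` that is polynomial in the `k`-th coordinate and periodic in it does not
depend on this coordinate. -/
theorem eq_of_polynomial_of_periodic {F : (ℕ+ → K) → K} {k : ℕ+}
    (hP : ∀ c : ℕ+ → K, ∃ P : Polynomial K, ∀ t : K, F (c + t • Pi.single k 1) = P.eval t)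
    (hF : ∀ c : ℕ+ → K, F (c + Pi.single k ((k : ℕ) : K)) = F (c + -Pi.single k ((k : ℕ) : K)))
    (c : ℕ+ → K) (t : K) : F (c + t • Pi.single k 1) = F c := by
  have hs : ∀ t : K, (Pi.single k t : ℕ+ → K) = t • Pi.single k 1 := fun t => by
    rw [← Pi.single_smul, smul_eq_mul, mul_one]
  have hstep : ∀ n : ℕ, F (c + ((n : K) * (2 * k : ℕ)) • Pi.single k 1) = F c := by
    intro n
    induction n with
    | zero => simp
    | succ n ih =>
      -- The midpoint between the `n`-th and the next multiple of the period `2k`, so that the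
      -- shifts by `±k` land on them.
      have h := hF (c + ((n : K) * (2 * k : ℕ) + (k : ℕ)) • Pi.single k 1)
      rw [hs ((k : ℕ) : K), ← neg_smul, add_assoc, add_assoc, ← add_smul, ← add_smul] at h
      rw [← ih]
      convert h using 4 <;> push_cast <;> ring
  obtain ⟨P, h⟩ := hP c
  have h0 : P - Polynomial.C (F c) = 0 := by
    refine polynomial_eq_zero_of_eval_mul (q := 2 * k) (by positivity) fun n => ?_
    rw [Polynomial.eval_sub, Polynomial.eval_C, ← h, hstep, sub_self]
  rw [h, sub_eq_zero.1 h0, Polynomial.eval_C]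

theorem coeff_expSeries_logSeries (m : ℕ+ →₀ ℕ) (c : ℕ+ → K) :
    coeff m (expSeries (logSeries c)) = closedCoeff m c := by
  classical
  induction hn : pDegree m using Nat.strong_induction_on generalizing m c with
  | _ n ih =>
    let F : (ℕ+ → K) → K := fun c => coeff m (expSeries (logSeries c)) - closedCoeff m c
    have hF : ∀ (k : ℕ+) (c : ℕ+ → K) (t : K), F (c + t • Pi.single k 1) = F c := by
      intro k
      refine eq_of_polynomial_of_periodic (fun c => ?_) fun c => ?_
      · obtain ⟨P, hP⟩ := exists_polynomial_coeff_expSeries_logSeries c k m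
        obtain ⟨Q, hQ⟩ := exists_polynomial_closedCoeff c k m
        exact ⟨P - Q, fun t => by simp only [F]; rw [hP, hQ, Polynomial.eval_sub]⟩
      · by_cases hk : m k = 0
        · have h1 := coeff_expSeries_logSeries_sub_of_eq_zero c hk
          have hd : ∀ l, l ≠ k → (Pi.single k ((k : ℕ) : K) : ℕ+ → K) l = 0 :=
            fun l hl => Pi.single_eq_of_ne hl _
          simp only [F]
          rw [closedCoeff_add_eq_of_eq_zero c _ hk hd, closedCoeff_add_eq_of_eq_zero c _ hk
            fun l hl => by rw [Pi.neg_apply, hd l hl, neg_zero], sub_eq_zero.1 h1]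
        · obtain ⟨m', rfl⟩ : ∃ m', m = m' + Finsupp.single k 1 := by
            have hle : Finsupp.single k 1 ≤ m := by
              rw [Finsupp.single_le_iff]
              omega
            exact ⟨m - Finsupp.single k 1, (tsub_add_cancel_of_le hle).symm⟩
          have hlt : pDegree m' < n := by
            rw [pDegree_add, pDegree_single] at hn
            have := k.pos
            omega
          have h1 := coeff_expSeries_logSeries_sub c k m'
          have h2 := closedCoeff_sub c k m'
          rw [ih _ hlt m' _ rfl] at h1
          simp only [F]
          -- By the induction hypothesis both difference equations have the same right-hand side.
          linear_combination h1 - h2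
    have hz : ∀ s : Finset ℕ+, F c = F fun l => if l ∈ s then 0 else c l := by
      intro s
      induction s using Finset.induction_on with
      | empty => simp
      | insert k s hk ih =>
        rw [ih, ← hF k (fun l => if l ∈ s then 0 else c l) (-c k)]
        congr 1
        funext l
        rcases eq_or_ne l k with rfl | hl
        · simp [hk]
        · simp [hl]
    have h0 : F c = 0 := by
      -- These finitely many coordinates include every one on which either side depends.
      rw [hz (indexBound m)]
      simp only [F]
      have hsub : ∀ l ∈ m.support, l ∈ indexBound m := by
        intro l hl
        by_contra h
        have h1 := lt_of_notMem_indexBound h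
        have h2 := pDegree_le m l
        have h3 : 1 * (l : ℕ) ≤ m l * l :=
          Nat.mul_le_mul_right _ (Nat.one_le_iff_ne_zero.2 (Finsupp.mem_support_iff.1 hl))
        omega
      rw [coeff_expSeries_logSeries_of_eq_zero fun l hl => if_pos hl, coeff_one]
      split_ifs with hm
      · subst hm
        simp [closedCoeff]
      · rw [closedCoeff_eq_zero hm fun l hl => if_pos (hsub l hl), sub_zero]
    exact sub_eq_zero.1 h0

end PowerSum

/-! ### Cycle types and coefficients of the cycle index. -/

namespace BijChar

open Equiv PowerSum

theorem numCycles_zero {n : ℕ} (π : Perm (Fin n)) : numCycles π 0 = 0 :=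
  Multiset.count_eq_zero.2 fun h => (π.partition.parts_pos h).ne' rfl

theorem exponent_cycleExponent {n : ℕ} (π : Perm (Fin n)) :
    exponent (cycleExponent π) = numCycles π := by
  funext i
  rcases Nat.eq_zero_or_pos i with rfl | hi
  · rw [numCycles_zero, exponent, dif_neg (by simp)]
  · lift i to ℕ+ using hi
    rw [exponent_coe, cycleExponent_apply]

theorem o_eq_dyadicWeight {n : ℕ} (π : Perm (Fin n)) (l : ℕ) :
    o π l = dyadicWeight (exponent (cycleExponent π)) l := by
  rw [exponent_cycleExponent]
  rfl

theorem cycleExponent_eq_iff_isConj {n : ℕ} (σ τ : Perm (Fin n)) :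
    cycleExponent σ = cycleExponent τ ↔ IsConj τ σ := by
  rw [Equiv.Perm.partition_eq_of_isConj, Nat.Partition.ext_iff, Multiset.ext]
  constructor
  · intro h i
    have := congrFun (congrArg exponent h) i
    rw [exponent_cycleExponent, exponent_cycleExponent] at this
    exact this.symm
  · intro h
    ext i
    rw [cycleExponent_apply, cycleExponent_apply]
    exact (h i).symm

theorem prod_support_cycleExponent {n : ℕ} (π : Perm (Fin n)) {M : Type*} [CommMonoid M]
    (f : ℕ → M) :
    ∏ l ∈ (cycleExponent π).support, f l = ∏ i ∈ π.partition.parts.toFinset, f i := by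
  refine Finset.prod_bij (fun l _ => (l : ℕ)) ?_ ?_ ?_ ?_
  · intro l hl
    rw [Finsupp.mem_support_iff, cycleExponent_apply] at hl
    exact Multiset.mem_toFinset.2 (Multiset.count_ne_zero.1 hl)
  · intro a _ b _ h
    exact PNat.eq h
  · intro i hi
    rw [Multiset.mem_toFinset] at hi
    obtain ⟨l, rfl⟩ : ∃ l : ℕ+, (l : ℕ) = i := ⟨⟨i, π.partition.parts_pos hi⟩, rfl⟩
    refine ⟨l, ?_, rfl⟩
    rw [Finsupp.mem_support_iff, cycleExponent_apply]
    exact Multiset.count_ne_zero.2 hi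
  · intros
    rfl

theorem pDegree_cycleExponent {n : ℕ} (π : Perm (Fin n)) : pDegree (cycleExponent π) = n := by
  have h : π.partition.parts.sum = n := π.partition.parts_sum.trans (Fintype.card_fin n)
  refine Eq.trans ?_ h
  rw [Finset.sum_multiset_count]
  have h2 := prod_support_cycleExponent π (fun i => Multiplicative.ofAdd (numCycles π i • i))
  rw [pDegree, Finsupp.weight_apply, Finsupp.sum]
  simp only [cycleExponent_apply]
  exact h2

/-- The number of permutations with given cycle lengths, times the order of the centralizer of
one of them, is `n!`. -/
theorem card_cycleExponent_mul {n : ℕ} (π : Perm (Fin n)) :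
    Nat.card {σ : Perm (Fin n) | cycleExponent σ = cycleExponent π} *
      ∏ l ∈ (cycleExponent π).support,
        ((l : ℕ) ^ (cycleExponent π l) * (cycleExponent π l).factorial) = n.factorial := by
  -- This formula is stated for `cycleType`, which omits fixed points; they enter through a separate
  -- factorial, to be matched with the `1`-cycles of `partition`.
  have h := Equiv.Perm.card_isConj_mul_eq π
  simp only [Fintype.card_fin] at h
  conv_rhs => rw [← h]
  simp only [cycleExponent_eq_iff_isConj, cycleExponent_apply]
  congr 1
  rw [prod_support_cycleExponent π (fun i => i ^ numCycles π i * (numCycles π i).factorial)]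
  have hparts : π.partition.parts = π.cycleType + Multiset.replicate (n - π.cycleType.sum) 1 := by
    rw [Equiv.Perm.parts_partition, Equiv.Perm.sum_cycleType]
    congr
    exact Fintype.card_fin n
  have h1 : 1 ∉ π.cycleType := fun h => by
    have := Equiv.Perm.two_le_of_mem_cycleType h
    omega
  have hc1 : numCycles π 1 = n - π.cycleType.sum := by
    rw [numCycles, hparts, Multiset.count_add, Multiset.count_eq_zero.2 h1,
      Multiset.count_replicate_self, zero_add]
  have hci : ∀ i ∈ π.cycleType.toFinset, numCycles π i = π.cycleType.count i := by
    intro i hi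
    rw [numCycles, hparts, Multiset.count_add, Multiset.count_replicate, if_neg, add_zero]
    rintro rfl
    exact h1 (Multiset.mem_toFinset.1 hi)
  have hsub : π.partition.parts.toFinset ⊆ insert 1 π.cycleType.toFinset := by
    intro i hi
    rw [Multiset.mem_toFinset, hparts, Multiset.mem_add] at hi
    rw [Finset.mem_insert, Multiset.mem_toFinset]
    exact hi.elim Or.inr fun h => Or.inl (Multiset.eq_of_mem_replicate h)
  rw [Finset.prod_subset hsub fun i _ hi => by
      rw [numCycles, Multiset.count_eq_zero.2 fun h => hi (Multiset.mem_toFinset.2 h)]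
      simp,
    Finset.prod_insert (by rwa [Multiset.mem_toFinset]), hc1, one_pow, one_mul,
    Finset.prod_multiset_count, mul_assoc, ← Finset.prod_mul_distrib]
  congr 1
  exact Finset.prod_congr rfl fun i hi => by rw [hci i hi]

variable {K : Type*} [CommRing K] [Algebra ℚ K]

theorem coeff_cycleIndexPart (χ : (n : ℕ) → Perm (Fin n) → K) (n : ℕ) (m : ℕ+ →₀ ℕ) :
    coeff m (cycleIndexPart χ n) = (1 / (n.factorial : ℚ)) •
      ∑ π : Perm (Fin n), coeff m (monomial (cycleExponent π) (χ n π)) := by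
  rw [← map_sum]
  rfl

/-- By degree only the part indexed by `n` contributes. There the value `χ n π` is counted once for
each conjugate of `π`, and the class size over `n!` is the inverse of the centralizer order. -/
theorem IsClassFunction.coeff_cycleIndex {χ : (n : ℕ) → Perm (Fin n) → K}
    (hχ : IsClassFunction χ) {n : ℕ} (π : Perm (Fin n)) :
    coeff (cycleExponent π) (cycleIndex χ) =
      (∏ l ∈ (cycleExponent π).support, 1 / cycleAut l (cycleExponent π l)) • χ n π := by
  classical
  change (∑ᶠ n' : ℕ, coeff (cycleExponent π) (cycleIndexPart χ n')) = _
  rw [finsum_eq_single _ n]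
  · have hsum : ∑ σ : Perm (Fin n), coeff (cycleExponent π) (monomial (cycleExponent σ) (χ n σ)) =
        (Nat.card {σ : Perm (Fin n) | cycleExponent σ = cycleExponent π} : ℚ) • χ n π := by
      have hcard : Nat.card {σ : Perm (Fin n) | cycleExponent σ = cycleExponent π} =
          (Finset.univ.filter fun σ => cycleExponent σ = cycleExponent π).card :=
        Nat.subtype_card _ (by simp)
      rw [hcard, Nat.cast_smul_eq_nsmul, ← Finset.sum_const, Finset.sum_filter]
      refine Finset.sum_congr rfl fun σ _ => ?_
      rw [coeff_monomial]
      by_cases h : cycleExponent σ = cycleExponent π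
      · rw [if_pos h, if_pos h.symm]
        obtain ⟨τ, hτ⟩ := isConj_iff.1 ((cycleExponent_eq_iff_isConj σ π).1 h)
        rw [← hτ, hχ]
      · rw [if_neg h, if_neg (Ne.symm h)]
    rw [coeff_cycleIndexPart, hsum, smul_smul]
    congr 1
    have hcard := congrArg (Nat.cast (R := ℚ)) (card_cycleExponent_mul π)
    rw [Nat.cast_mul, Nat.cast_prod] at hcard
    have hz : ∏ l ∈ (cycleExponent π).support, (((l : ℕ) ^ (cycleExponent π l) *
        (cycleExponent π l).factorial : ℕ) : ℚ) =
        ∏ l ∈ (cycleExponent π).support, cycleAut l (cycleExponent π l) :=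
      Finset.prod_congr rfl fun l _ => by rw [cycleAut]; push_cast; rfl
    rw [hz] at hcard
    have hn : (n.factorial : ℚ) ≠ 0 := by positivity
    have hne : ∏ l ∈ (cycleExponent π).support, cycleAut l (cycleExponent π l) ≠ 0 :=
      fun h => hn (by rw [← hcard, h, mul_zero])
    rw [Finset.prod_div_distrib, Finset.prod_const_one]
    field_simp
    exact hcard
  · intro n' hn'
    rw [coeff_cycleIndexPart, Finset.sum_eq_zero, smul_zero]
    intro σ _
    rw [coeff_monomial, if_neg]
    intro h
    apply hn'
    rw [← pDegree_cycleExponent σ, ← h, pDegree_cycleExponent]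

end BijChar

/-! ### The character formula. -/

theorem lemma4p3 {K : Type*} [CommRing K] [Algebra ℚ K] (c : ℕ+ → K)
    (χ : (n : ℕ) → Equiv.Perm (Fin n) → K) (hχ : BijChar.IsClassFunction χ)
    (hZ : BijChar.cycleIndex χ = PowerSum.expSeries (PowerSum.seriesSum fun l : ℕ+ =>
      (1 / ((l : ℕ) : ℚ)) • c l •
        (PowerSum.plethysm PowerSum.XSeries (MvPowerSeries.X l)).map (algebraMap ℚ K)))
    (n : ℕ) (π : Equiv.Perm (Fin n)) :
    χ n π = ∏ᶠ l : ℕ+,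
      BijChar.charFactor (c l) (BijChar.o π l) l (BijChar.numCycles π l) := by
  set m := BijChar.cycleExponent π with hm
  have h1 := hχ.coeff_cycleIndex π
  have h2 : coeff m (BijChar.cycleIndex χ) = PowerSum.closedCoeff m c := by
    rw [hZ]
    exact PowerSum.coeff_expSeries_logSeries m c
  have hz : ∀ l : ℕ+, PowerSum.cycleAut l (m l) ≠ 0 := by
    intro l
    have := l.pos
    rw [PowerSum.cycleAut]
    positivity
  rw [h2, PowerSum.closedCoeff, Finset.prod_smul] at h1
  -- Both expressions for the coefficient carry the same inverse centralizer order, which is cleared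
  -- here.
  have h3 := congrArg ((∏ l ∈ m.support, PowerSum.cycleAut l (m l)) • ·) h1
  have h4 : (∏ l ∈ m.support, PowerSum.cycleAut l (m l)) *
      ∏ l ∈ m.support, 1 / PowerSum.cycleAut l (m l) = 1 := by
    rw [← Finset.prod_mul_distrib]
    exact Finset.prod_eq_one fun l _ => mul_one_div_cancel (hz l)
  simp only [smul_smul, ← hm] at h3
  rw [h4, one_smul, one_smul] at h3
  rw [← h3, finprod_eq_prod_of_mulSupport_subset (s := m.support)]
  · refine Finset.prod_congr rfl fun l _ => ?_
    rw [BijChar.o_eq_dyadicWeight, ← BijChar.cycleExponent_apply]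
  · intro l hl
    by_contra h
    refine hl ?_
    dsimp only
    rw [← BijChar.cycleExponent_apply, ← hm, Finsupp.notMem_support_iff.1 h,
      BijChar.charFactor_zero]
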